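/- Let $(R,\mathfrak m)=(R_0,\mathfrak m_0)$ be a regular local ring with field of fractions $K$, and let $R_0\subseteq R_1\subseteq R_2\subseteq\cdots$ be an infinite sequence of local subrings $(R_n,\mathfrak m_n)$ of $K$ such that each $R_{n+1}$ is a local quadratic transform of $R_n$; that is, $R_{n+1}=R_n[\mathfrak m_n/x]_{\mathfrak p}$ for some $x\in\mathfrak m_n\setminus\mathfrak m_n^2$ and some prime ideal $\mathfrak p$ of $R_n[\mathfrak m_n/x]$ containing $\mathfrak m_n$. Assume that the family $\{R_n\}_{n\ge 0}$ switches strongly infinitely often; that is, there are no integer $j\ge 0$ and height one prime ideal $\mathfrak p$ of $R_j$ such that $\bigcup_{n\ge 0}R_n\subseteq (R_j)_{\mathfrak p}$. For a valuation domain $W$ with $R\subseteq W\subseteq K$, an ideal $I$ of $R$ is called a $W$-ideal (a valuation ideal for $W$) if $IW\cap R=I$. A valuation domain $W$ with maximal ideal $\mathfrak m_W$ birationally dominates $R_n$ if $R_n\subseteq W\subseteq K$ and $\mathfrak m_W\cap R_n=\mathfrak m_n$. Then $V=\bigcup_{n\ge 0}R_n$ is a valuation domain of rank one (Krull dimension one),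 the nonzero $V$-ideals of $R$ form an infinite strictly descending sequence $I_0\supsetneq I_1\supsetneq I_2\supsetneq\cdots$ with $\bigcap_{n\ge 0}I_n=(0)$, and there exists a strictly ascending sequence of nonnegative integers $\{\tau_n\}_{n\ge 0}$ such that, for every $n\ge 0$ and every valuation domain $W$ that birationally dominates $R_{\tau_n}$, the ideals $I_1,\ldots,I_n$ are $W$-ideals of $R$. -/

import Mathlib

open IsLocalRing

/-- The subring `R[𝔪/x]` of the field `K`, for a local subring `(R, 𝔪)` of `K` and `x ∈ R`. -/
def blowupChart {K : Type*} [Field K] (R : LocalSubring K) (x : R.toSubring) : Subring K :=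
  Subring.closure ((R.toSubring : Set K) ∪
    {y : K | ∃ a ∈ maximalIdeal R.toSubring, y = (a : K) / (x : K)})

theorem le_blowupChart {K : Type*} [Field K] (R : LocalSubring K) (x : R.toSubring) :
    R.toSubring ≤ blowupChart R x :=
  fun _ ha => Subring.subset_closure (Or.inl ha)

/-- `R₁` is a local quadratic transform of the local ring `(R, 𝔪)`: it is the localization
`R[𝔪/x]_𝔭` for some `x ∈ 𝔪 ∖ 𝔪²` and some prime ideal `𝔭` of `R[𝔪/x]` containing `𝔪`. -/
def IsLocalQuadraticTransform {K : Type*} [Field K] (R R₁ : LocalSubring K) : Prop :=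
  ∃ x : R.toSubring, x ∈ maximalIdeal R.toSubring ∧ x ∉ maximalIdeal R.toSubring ^ 2 ∧
    ∃ (𝔭 : Ideal (blowupChart R x)) (_ : 𝔭.IsPrime),
      (maximalIdeal R.toSubring).map (Subring.inclusion (le_blowupChart R x)) ≤ 𝔭 ∧
      R₁ = LocalSubring.ofPrime (blowupChart R x) 𝔭

/-- The family `R n` switches strongly infinitely often: there is no `j` and no height one prime
`𝔭` of `R j` such that `⋃ n, R n` is contained in the localization `(R j)_𝔭`. -/
def SwitchesStronglyInfinitelyOften {K : Type*} [Field K] (R : ℕ → LocalSubring K) : Prop :=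
  ¬ ∃ (j : ℕ) (𝔭 : Ideal (R j).toSubring) (_ : 𝔭.IsPrime), 𝔭.height = 1 ∧
    (⋃ n, ((R n).toSubring : Set K)) ⊆ (LocalSubring.ofPrime (R j).toSubring 𝔭).toSubring

/-- `I` is a `V`-ideal of the subring `A` of `K`, where `V` is a valuation ring of `K`:
`A ⊆ V` and `IV ∩ A = I`. -/
def IsValuationIdealFor {K : Type*} [Field K] {A : Subring K} (V : ValuationSubring K)
    (I : Ideal A) : Prop :=
  ∃ h : A ≤ V.toSubring,
    (I.map (Subring.inclusion h)).comap (Subring.inclusion h) = I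

/-- The valuation ring `W` of `K` dominates the local subring `R` of `K`. When `K` is the field of
fractions of `R`, these `W` are the valuation domains that birationally dominate `R`. -/
def Dominates {K : Type*} [Field K] (W : ValuationSubring K) (R : LocalSubring K) : Prop :=
  R ≤ W.toLocalSubring

/-! The engine is the behaviour of order under one quadratic transform. If R is regular with 𝔪
generated by x and a minimal set of further parameters yᵢ, then R[𝔪/x] modulo x is the polynomial
ring over the residue field in the yᵢ/x. Hence the transform is again regular and x is prime in it.
Moreover, if f has order r, then f/x^r has order at most r and is not divisible by x: modulo x it is
a nonzero polynomial of degree at most r, and such a polynomial has order at most r at every prime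
(`IsLocalQuadraticTransform.exists_isExceptionalParameter`).

Given f and g, divide both by x^r, where r is the smaller of their orders, and repeat. The smaller
order never increases. If it reaches zero, f/g or g/f lies in the union. If it stabilizes at a
positive value, the strict transforms of one element stay in the maximal ideals forever, and
finiteness of minimal primes produces a height one prime whose localization contains every later
ring, which strong switching forbids. So V is a valuation ring. A nonzero nonmaximal prime of V
would eventually avoid all exceptional parameters, which again places V inside a localization at a
height one prime; so V has rank one.

Rank one and the Artinian quotients of R by powers of 𝔪 make the values of V on nonzero elements of
R a single sequence v(a₀) > v(a₁) > ⋯ (values are written multiplicatively). The nonzero V-ideals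
are the sets of b with v(b) ≤ v(aₙ). They are finitely generated, so finitely many of the
divisibilities b/aᵢ ∈ V already hold in some R_T. A valuation dominating R_T then compares these
elements exactly as V does. -/

/-! ### Local algebra: parameters and regularity. -/

/-- Positive dimension keeps x from being nilpotent, and Krull's intersection theorem writes each
nonzero element as a power of x times a unit. -/
theorem IsLocalRing.isDomain_of_maximalIdeal_eq_span_singleton {Q : Type*} [CommRing Q]
    [IsLocalRing Q] [IsNoetherianRing Q] {x : Q} (hx : maximalIdeal Q = Ideal.span {x})
    (hd : 1 ≤ ringKrullDim Q) : IsDomain Q ∧ x ≠ 0 := by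
  have hnil : ∀ n : ℕ, x ^ n ≠ 0 := by
    intro n hn
    have h0 : Ring.KrullDimLE 0 Q := Ring.krullDimLE_zero_iff.mpr fun J hJ => by
      have hxJ : x ∈ J := hJ.mem_of_pow_mem n (by rw [hn]; exact J.zero_mem)
      have hle : maximalIdeal Q ≤ J := by
        rw [hx, Ideal.span_singleton_le_iff_mem]; exact hxJ
      rw [← le_antisymm hle (le_maximalIdeal hJ.ne_top)]
      exact maximalIdeal.isMaximal Q
    have h1 : ringKrullDim Q ≤ 0 := h0.krullDim_le
    exact absurd (hd.trans h1) (by norm_num)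
  have key : ∀ a : Q, a ≠ 0 → ∃ (n : ℕ) (u : Q), IsUnit u ∧ a = x ^ n * u := by
    intro a ha
    have hex : ∃ n : ℕ, a ∉ maximalIdeal Q ^ n := by
      by_contra! hall
      apply ha
      have h := Ideal.iInf_pow_eq_bot_of_isLocalRing (maximalIdeal Q)
        (maximalIdeal.isMaximal Q).ne_top
      rw [← Ideal.mem_bot, ← h, Ideal.mem_iInf]
      exact hall
    classical
    obtain ⟨m, hm⟩ : ∃ m, Nat.find hex = m + 1 := by
      refine Nat.exists_eq_succ_of_ne_zero fun h0 => ?_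
      have := Nat.find_spec hex
      rw [h0] at this
      simp at this
    have h1 : a ∈ maximalIdeal Q ^ m := by
      by_contra h; have := Nat.find_min' hex h; omega
    have h2 : a ∉ maximalIdeal Q ^ (m + 1) := hm ▸ Nat.find_spec hex
    rw [hx, Ideal.span_singleton_pow, Ideal.mem_span_singleton'] at h1
    obtain ⟨u, rfl⟩ := h1
    refine ⟨m, u, ?_, mul_comm _ _⟩
    by_contra hu
    apply h2
    rw [pow_succ']
    exact Ideal.mul_mem_mul ((mem_maximalIdeal u).mpr hu)
      (Ideal.pow_mem_pow (hx ▸ Ideal.mem_span_singleton_self x) m)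
  refine ⟨?_, by simpa using hnil 1⟩
  have : NoZeroDivisors Q := ⟨fun {a b} hab => by
    by_contra! hne
    obtain ⟨n, u, hu, rfl⟩ := key a hne.1
    obtain ⟨m, v, hv, rfl⟩ := key b hne.2
    apply hnil (n + m)
    have : x ^ (n + m) * (u * v) = 0 := by rw [← hab]; ring
    exact (hu.mul hv).mul_left_eq_zero.mp this⟩
  exact NoZeroDivisors.to_isDomain Q

/-- Omitting one member of a system of `dim D` generators of the maximal ideal of `D` leaves
generators of a prime ideal that does not contain the omitted element. -/
theorem IsLocalRing.isPrime_span_of_maximalIdeal_eq_span_insert {D : Type*} [CommRing D]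
    [IsLocalRing D] [IsNoetherianRing D] {x : D} {s : Finset D}
    (hx : maximalIdeal D = Ideal.span (insert x (s : Set D)))
    (hd : ((s.card + 1 : ℕ) : WithBot ℕ∞) ≤ ringKrullDim D) :
    (Ideal.span (s : Set D)).IsPrime ∧ x ∉ Ideal.span (s : Set D) := by
  have hs : (s : Set D) ⊆ maximalIdeal D := by
    rw [hx]; exact (Set.subset_insert _ _).trans Ideal.subset_span
  have hne : Ideal.span (s : Set D) ≠ ⊤ := fun h =>
    (maximalIdeal.isMaximal D).ne_top (top_le_iff.mp (h ▸ Ideal.span_le.mpr hs))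
  have : Nontrivial (D ⧸ Ideal.span (s : Set D)) := Ideal.Quotient.nontrivial_iff.mpr hne
  have : IsLocalRing (D ⧸ Ideal.span (s : Set D)) :=
    IsLocalRing.of_surjective' _ Ideal.Quotient.mk_surjective
  -- Dividing by the elements of s lowers the dimension by at most their number, so the quotient has
  -- dimension at least one, and its maximal ideal is generated by the image of x.
  have hdim := hd.trans (ringKrullDim_le_ringKrullDim_quotient_add_card s
    (by rwa [IsLocalRing.ringJacobson_eq_maximalIdeal]))
  have hone : 1 ≤ ringKrullDim (D ⧸ Ideal.span (s : Set D)) := by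
    rcases h : ringKrullDim (D ⧸ Ideal.span (s : Set D)) with _ | _ | k
    · exact absurd h ringKrullDim_ne_bot
    · exact le_top (α := WithBot ℕ∞)
    · rw [h] at hdim
      change ((s.card + 1 : ℕ) : WithBot ℕ∞) ≤ ((k : ℕ) : WithBot ℕ∞) + _ at hdim
      change ((1 : ℕ) : WithBot ℕ∞) ≤ ((k : ℕ) : WithBot ℕ∞)
      norm_cast at hdim ⊢
      omega
  have hmax : maximalIdeal (D ⧸ Ideal.span (s : Set D)) =
      Ideal.span {Ideal.Quotient.mk (Ideal.span (s : Set D)) x} := by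
    have h1 : maximalIdeal (D ⧸ Ideal.span (s : Set D)) =
        (maximalIdeal D).map (Ideal.Quotient.mk (Ideal.span (s : Set D))) :=
      (IsLocalRing.map_maximalIdeal_of_surjective _ Ideal.Quotient.mk_surjective).symm
    rw [h1, hx, Ideal.map_span, Set.image_insert_eq]
    refine le_antisymm (Ideal.span_le.mpr ?_) (Ideal.span_mono (by simp))
    rintro _ (rfl | ⟨y, hy, rfl⟩)
    · exact Ideal.subset_span rfl
    · rw [Ideal.Quotient.eq_zero_iff_mem.mpr (Ideal.subset_span hy)]; exact Ideal.zero_mem _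
  obtain ⟨hdom, hx0⟩ := isDomain_of_maximalIdeal_eq_span_singleton hmax hone
  refine ⟨(Ideal.Quotient.isDomain_iff_prime _).mp hdom, ?_⟩
  rwa [Ne, Ideal.Quotient.eq_zero_iff_mem] at hx0

/-- A system of `dim R` generators containing a given element of `𝔪 ∖ 𝔪²`. -/
theorem IsRegularLocalRing.exists_finset_maximalIdeal_eq_span_insert {R : Type*} [CommRing R]
    [IsRegularLocalRing R] {x : R} (hx : x ∈ maximalIdeal R) (hx2 : x ∉ maximalIdeal R ^ 2) :
    ∃ s : Finset R, maximalIdeal R = Ideal.span (insert x (s : Set R)) ∧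
      ((s.card + 1 : ℕ) : WithBot ℕ∞) ≤ ringKrullDim R := by
  classical
  have fg : (maximalIdeal R).FG := (maximalIdeal R).fg_of_isNoetherianRing
  set t : Finset R := (Submodule.FG.finite_generators fg).toFinset with ht
  have htspan : Ideal.span (t : Set R) = maximalIdeal R := by
    rw [ht, Set.Finite.coe_toFinset]; exact (maximalIdeal R).span_generators
  have htcard : t.card = (maximalIdeal R).spanFinrank := by
    rw [← Submodule.FG.generators_ncard fg, Set.ncard_eq_toFinset_card _ (Submodule.FG.finite_generators fg)]
  have hxt : x ∈ Submodule.span R (t : Set R) := by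
    change x ∈ Ideal.span (t : Set R); rw [htspan]; exact hx
  obtain ⟨c, hc⟩ := Submodule.mem_span_finset'.mp hxt
  -- With only nonunit coefficients x would lie in 𝔪²; a generator with unit coefficient can be
  -- exchanged for x.
  obtain ⟨z, hz⟩ : ∃ z : t, IsUnit (c z) := by
    by_contra! hall
    apply hx2
    rw [← hc, pow_two]
    refine Ideal.sum_mem _ fun z _ => Ideal.mul_mem_mul ((mem_maximalIdeal _).mpr (hall z)) ?_
    rw [← htspan]; exact Ideal.subset_span z.2
  refine ⟨t.erase z, le_antisymm ?_ ?_, ?_⟩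
  · rw [← htspan, Ideal.span_le]
    intro w hw
    by_cases hwz : w = z
    · subst hwz
      have h1 : c z • (z : R) ∈ Ideal.span (insert x ((t.erase (z : R) : Finset R) : Set R)) := by
        have h2 : c z • (z : R) = x - ∑ a ∈ Finset.univ.erase z, c a • (a : R) := by
          rw [← hc, ← Finset.add_sum_erase _ _ (Finset.mem_univ z)]; ring
        rw [h2]
        refine Ideal.sub_mem _ (Ideal.subset_span (Set.mem_insert _ _))
          (Ideal.sum_mem _ fun a ha => Ideal.mul_mem_left _ _ (Ideal.subset_span ?_))
        refine Set.mem_insert_of_mem _ ?_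
        rw [Finset.mem_coe, Finset.mem_erase]
        exact ⟨fun h => (Finset.mem_erase.mp ha).1 (Subtype.ext h), a.2⟩
      exact (Ideal.unit_mul_mem_iff_mem _ hz).mp h1
    · exact Ideal.subset_span (Set.mem_insert_of_mem _ (by
        rw [Finset.mem_coe, Finset.mem_erase]; exact ⟨hwz, hw⟩))
  · rw [Ideal.span_le]
    rintro w (rfl | hw)
    · exact hx
    · rw [← htspan]; exact Ideal.subset_span (Finset.mem_of_mem_erase hw)
  · rw [Finset.card_erase_add_one z.2, htcard, IsRegularLocalRing.spanFinrank_maximalIdeal]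

/-- Lifts of minimal generators from S/(x), together with x, generate the maximal ideal, while the
nonzerodivisor x raises the dimension by at least one. -/
theorem IsRegularLocalRing.of_surjective_of_ker_eq_span_singleton {S B : Type*} [CommRing S]
    [CommRing B] [IsDomain S] [IsLocalRing S] [IsNoetherianRing S] [IsRegularLocalRing B]
    (f : S →+* B) (hf : Function.Surjective f) {x : S} (hx0 : x ≠ 0)
    (hker : RingHom.ker f = Ideal.span {x}) : IsRegularLocalRing S := by
  classical
  have fg : (maximalIdeal B).FG := (maximalIdeal B).fg_of_isNoetherianRing
  set t : Finset B := (Submodule.FG.finite_generators fg).toFinset with ht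
  have htspan : Ideal.span (t : Set B) = maximalIdeal B := by
    rw [ht, Set.Finite.coe_toFinset]; exact (maximalIdeal B).span_generators
  have htcard : t.card = (maximalIdeal B).spanFinrank := by
    rw [← Submodule.FG.generators_ncard fg, Set.ncard_eq_toFinset_card _ (Submodule.FG.finite_generators fg)]
  choose g hg using hf
  have hfm : (maximalIdeal S).map f = maximalIdeal B :=
    IsLocalRing.map_maximalIdeal_of_surjective _ (fun b => ⟨g b, hg b⟩)
  have hle : maximalIdeal S ≤ Ideal.span (insert x (t.image g : Set S)) := by
    intro a ha
    have h1 : f a ∈ (Ideal.span (t.image g : Set S)).map f := by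
      rw [Ideal.map_span, Finset.coe_image, ← Set.image_comp]
      have : (f ∘ g) '' (t : Set B) = t := by
        rw [show f ∘ g = id from funext hg, Set.image_id]
      rw [this, htspan, ← hfm]
      exact Ideal.mem_map_of_mem f ha
    obtain ⟨b, hb, hba⟩ := (Ideal.mem_map_iff_of_surjective f (fun b => ⟨g b, hg b⟩)).mp h1
    have h2 : a - b ∈ Ideal.span {x} := by
      rw [← hker, RingHom.mem_ker, map_sub, hba, sub_self]
    rw [← sub_add_cancel a b]
    exact Ideal.add_mem _ (Ideal.span_mono (by simp) h2) (Ideal.span_mono (Set.subset_insert _ _) hb)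
  have heq : maximalIdeal S = Ideal.span ((insert x (t.image g) : Finset S) : Set S) := by
    rw [Finset.coe_insert]
    refine le_antisymm hle (Ideal.span_le.mpr ?_)
    have hloc : maximalIdeal S = (maximalIdeal B).comap f := by
      have : IsLocalHom f := IsLocalHom.of_surjective f (fun b => ⟨g b, hg b⟩)
      exact (IsLocalRing.maximalIdeal_comap f).symm
    rintro w (rfl | hw)
    · rw [hloc]
      have : w ∈ RingHom.ker f := hker ▸ Ideal.mem_span_singleton_self w
      change f w ∈ maximalIdeal B
      rw [(RingHom.mem_ker).mp this]; exact Ideal.zero_mem _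
    · obtain ⟨b, hb, rfl⟩ := Finset.mem_image.mp (Finset.mem_coe.mp hw)
      rw [hloc]; change f (g b) ∈ maximalIdeal B
      rw [hg, ← htspan]; exact Ideal.subset_span hb
  apply IsRegularLocalRing.of_spanFinrank_maximalIdeal_le
  have e : (S ⧸ Ideal.span {x}) ≃+* B :=
    (Ideal.quotEquivOfEq hker.symm).trans (RingHom.quotientKerEquivOfSurjective (fun b => ⟨g b, hg b⟩))
  have hdim := ringKrullDim_quotient_succ_le_of_nonZeroDivisor (mem_nonZeroDivisors_of_ne_zero hx0)
  rw [ringKrullDim_eq_of_ringEquiv e, ← IsRegularLocalRing.spanFinrank_maximalIdeal, ← htcard] at hdim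
  refine le_trans ?_ hdim
  have hcard : (maximalIdeal S).spanFinrank ≤ t.card + 1 := by
    rw [heq]
    refine (Submodule.spanFinrank_span_le_ncard_of_finite (Finset.finite_toSet _)).trans ?_
    rw [Set.ncard_coe_finset]
    exact (Finset.card_insert_le _ _).trans (Nat.add_le_add_right Finset.card_image_le 1)
  exact_mod_cast hcard

/-! ### Polynomial relations among the yᵢ/x. -/

theorem MvPolynomial.exists_C_pow_mul_sub_C_mem_span {R ι : Type*} [CommRing R] (x : R) (y : ι → R)
    (G : MvPolynomial ι R) : ∃ (N : ℕ) (c : R), C x ^ N * G - C c ∈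
      Ideal.span (Set.range fun i => C x * X i - C (y i) : Set (MvPolynomial ι R)) := by
  induction G using MvPolynomial.induction_on with
  | C a => exact ⟨0, a, by simp⟩
  | add p q hp hq =>
    obtain ⟨N, c, hc⟩ := hp
    obtain ⟨M, d, hd⟩ := hq
    refine ⟨N + M, x ^ M * c + x ^ N * d, ?_⟩
    have : C x ^ (N + M) * (p + q) - C (x ^ M * c + x ^ N * d) =
        C x ^ M * (C x ^ N * p - C c) + C x ^ N * (C x ^ M * q - C d) := by
      simp only [map_add, map_mul, map_pow]; ring
    rw [this]
    exact Ideal.add_mem _ (Ideal.mul_mem_left _ _ hc) (Ideal.mul_mem_left _ _ hd)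
  | mul_X p i hp =>
    obtain ⟨N, c, hc⟩ := hp
    refine ⟨N + 1, c * y i, ?_⟩
    have : C x ^ (N + 1) * (p * X i) - C (c * y i) =
        C x * X i * (C x ^ N * p - C c) + C c * (C x * X i - C (y i)) := by
      simp only [map_mul]; ring
    rw [this]
    exact Ideal.add_mem _ (Ideal.mul_mem_left _ _ hc)
      (Ideal.mul_mem_left _ _ (Ideal.subset_span ⟨i, rfl⟩))

instance MvPolynomial.isPrime_ker_map_residue {R ι : Type*} [CommRing R] [IsLocalRing R] :
    (RingHom.ker (map (residue R) :
      MvPolynomial ι R →+* MvPolynomial ι (ResidueField R))).IsPrime :=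
  RingHom.ker_isPrime _

/-- The kernel lies over the maximal ideal, and going down for R → R[X] bounds its height below. -/
theorem MvPolynomial.ringKrullDim_le_of_ker_map_residue {R ι D : Type*} [CommRing R] [IsLocalRing R]
    [IsNoetherianRing R] [Finite ι] [CommRing D] [Algebra (MvPolynomial ι R) D]
    [IsLocalization.AtPrime D (RingHom.ker (map (residue R) :
      MvPolynomial ι R →+* MvPolynomial ι (ResidueField R)))] :
    ringKrullDim R ≤ ringKrullDim D := by
  set P := RingHom.ker (map (residue R) : MvPolynomial ι R →+* MvPolynomial ι (ResidueField R))
  have hlo : P.LiesOver (maximalIdeal R) := ⟨by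
    ext a
    simp [P, RingHom.mem_ker, Ideal.mem_comap, Ideal.under, algebraMap_eq, residue_eq_zero_iff]⟩
  rw [IsLocalization.AtPrime.ringKrullDim_eq_height P D, ← maximalIdeal_height_eq_ringKrullDim,
    Ideal.height_eq_height_add_of_liesOver_of_hasGoingDown (maximalIdeal R) P]
  exact_mod_cast le_self_add

/-- Affine charts of the blowup of a regular local ring: a polynomial relation between the
`yᵢ / x` has all its coefficients in the maximal ideal. -/
theorem IsLocalRing.map_residue_eq_zero_of_aeval_div_eq_zero {R K : Type*} [CommRing R]
    [IsLocalRing R] [IsNoetherianRing R] [Field K] [Algebra R K]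
    (hinj : Function.Injective (algebraMap R K)) {x : R} {s : Finset R} (hx0 : x ≠ 0)
    (hx : maximalIdeal R = Ideal.span (insert x (s : Set R)))
    (hd : ((s.card + 1 : ℕ) : WithBot ℕ∞) ≤ ringKrullDim R)
    {G : MvPolynomial s R}
    (hG : MvPolynomial.aeval (fun i : s => algebraMap R K i / algebraMap R K x) G = 0) :
    MvPolynomial.map (residue R) G = 0 := by
  classical
  set P := RingHom.ker (MvPolynomial.map (residue R) :
    MvPolynomial s R →+* MvPolynomial s (ResidueField R)) with hP
  have hPprime : P.IsPrime := MvPolynomial.isPrime_ker_map_residue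
  have hPmap : P = (maximalIdeal R).map MvPolynomial.C := by
    rw [hP, MvPolynomial.ker_map, IsLocalRing.ker_residue]
  let D := Localization.AtPrime P
  let α := algebraMap (MvPolynomial s R) D
  let u : s → MvPolynomial s R := fun i =>
    MvPolynomial.C x * MvPolynomial.X i - MvPolynomial.C (i : R)
  let t : Finset D := Finset.univ.image fun i => α (u i)
  have hxK : algebraMap R K x ≠ 0 := fun h => hx0 (hinj (by rw [h, map_zero]))
  -- Modulo x the elements uᵢ = xXᵢ − yᵢ become −yᵢ, so x and the uᵢ form a system of parameters of
  -- the localization D; hence the uᵢ generate a prime of D avoiding x.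
  have hspan : P = Ideal.span (insert (MvPolynomial.C x) (Set.range u)) := by
    refine le_antisymm ?_ (Ideal.span_le.mpr ?_)
    · rw [hPmap, hx, Ideal.map_span, Ideal.span_le]
      have hxm : (MvPolynomial.C x : MvPolynomial s R) ∈
          Ideal.span (insert (MvPolynomial.C x) (Set.range u)) :=
        Ideal.subset_span (Set.mem_insert _ _)
      rintro _ ⟨z, (rfl | hz), rfl⟩
      · exact hxm
      · have : (MvPolynomial.C z : MvPolynomial s R) =
            MvPolynomial.X ⟨z, hz⟩ * MvPolynomial.C x - u ⟨z, hz⟩ := by simp only [u]; ring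
        rw [this]
        exact Ideal.sub_mem _ (Ideal.mul_mem_left _ _ hxm)
          (Ideal.subset_span (Set.mem_insert_of_mem _ ⟨_, rfl⟩))
    · have hmem : ∀ z ∈ insert x (s : Set R), (MvPolynomial.C z : MvPolynomial s R) ∈ P := by
        intro z hz
        rw [hPmap]
        exact Ideal.mem_map_of_mem _ (hx ▸ Ideal.subset_span hz)
      rintro _ (rfl | ⟨i, rfl⟩)
      · exact hmem x (Set.mem_insert _ _)
      · exact Ideal.sub_mem _ (Ideal.mul_mem_right _ _ (hmem x (Set.mem_insert _ _)))
          (hmem i (Set.mem_insert_of_mem _ i.2))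
  have hmax : maximalIdeal D = Ideal.span (insert (α (MvPolynomial.C x)) (t : Set D)) := by
    rw [← Localization.AtPrime.map_eq_maximalIdeal (I := P)]
    refine (congrArg (Ideal.map α) hspan).trans ?_
    rw [Ideal.map_span, Set.image_insert_eq]
    congr 2
    simp only [t, Finset.coe_image, Finset.coe_univ, Set.image_univ]
    rw [← Set.range_comp]; rfl
  have hdim : ((t.card + 1 : ℕ) : WithBot ℕ∞) ≤ ringKrullDim D := by
    refine le_trans ?_ (hd.trans (MvPolynomial.ringKrullDim_le_of_ker_map_residue (ι := s)))
    have : t.card ≤ s.card := Finset.card_image_le.trans (by simp)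
    exact_mod_cast Nat.add_le_add_right this 1
  have hnoeth : IsNoetherianRing D := IsLocalization.isNoetherianRing P.primeCompl D inferInstance
  obtain ⟨hprime, hxt⟩ := isPrime_span_of_maximalIdeal_eq_span_insert hmax hdim
  obtain ⟨N, c, hc⟩ := MvPolynomial.exists_C_pow_mul_sub_C_mem_span x (fun i : s => (i : R)) G
  have hu0 : Ideal.span (Set.range u) ≤ RingHom.ker
      (MvPolynomial.aeval fun i : s => algebraMap R K i / algebraMap R K x) := by
    rw [Ideal.span_le]
    rintro _ ⟨i, rfl⟩
    simp only [u, SetLike.mem_coe, RingHom.mem_ker, map_sub, map_mul, MvPolynomial.aeval_X,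
      MvPolynomial.algHom_C]
    field_simp
    simp
  -- Both G and the uᵢ vanish at Xᵢ = yᵢ/x, so the constant c does too.
  have hc0 : c = 0 := by
    have h := hu0 hc
    rw [RingHom.mem_ker, map_sub, map_mul, hG, mul_zero, zero_sub, neg_eq_zero,
      MvPolynomial.algHom_C] at h
    exact hinj (by rw [h, map_zero])
  rw [hc0, map_zero, sub_zero] at hc
  have hD : α (MvPolynomial.C x) ^ N * α G ∈ Ideal.span (t : Set D) := by
    have h := Ideal.mem_map_of_mem α hc
    rw [Ideal.map_span, ← Set.range_comp, map_mul, map_pow] at h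
    refine Ideal.span_mono ?_ h
    rintro _ ⟨i, rfl⟩
    exact Finset.mem_coe.mpr (Finset.mem_image_of_mem _ (Finset.mem_univ i))
  have hGt : α G ∈ Ideal.span (t : Set D) :=
    (hprime.mem_or_mem hD).resolve_left fun h => hxt (hprime.mem_of_pow_mem N h)
  have hGm : α G ∈ maximalIdeal D := by
    rw [hmax]; exact Ideal.span_mono (Set.subset_insert _ _) hGt
  have : G ∈ P := by
    rw [← IsLocalization.AtPrime.to_map_mem_maximal_iff D P]; exact hGm
  exact (RingHom.mem_ker).mp this

/-! ### Order of a polynomial at a prime. -/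

/-- A nonzero polynomial of degree at most `r` over a field has order at most `r` at every prime
ideal of the polynomial ring. -/
theorem MvPolynomial.mul_notMem_pow_of_totalDegree_le {k ι : Type*} [Field k]
    {P : Ideal (MvPolynomial ι k)} [hP : P.IsPrime] {F s : MvPolynomial ι k} {r : ℕ} (hF : F ≠ 0)
    (hr : F.totalDegree ≤ r) (hs : s ∉ P) : s * F ∉ P ^ (r + 1) := by
  intro hmem
  let L := FractionRing (MvPolynomial ι k ⧸ P)
  let ε : MvPolynomial ι k →ₐ[k] L :=
    (IsScalarTower.toAlgHom k (MvPolynomial ι k ⧸ P) L).comp (Ideal.Quotient.mkₐ k P)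
  have hε : ∀ p, ε p = 0 ↔ p ∈ P := by
    intro p
    rw [← Ideal.Quotient.eq_zero_iff_mem]
    exact map_eq_zero_iff _ (IsFractionRing.injective (MvPolynomial ι k ⧸ P) L)
  -- Over the residue field L of P, this translation moves the generic point of P to the origin, so
  -- it sends P into the ideal of the variables. The opposite translation κ shows that it kills no
  -- nonzero polynomial.
  let τ : MvPolynomial ι k →ₐ[k] MvPolynomial ι L := aeval fun i => X i + C (ε (X i))
  let κ : MvPolynomial ι L →ₐ[L] MvPolynomial ι L := aeval fun i => X i - C (ε (X i))
  have hκτ : ∀ p, κ (τ p) = map (algebraMap k L) p := by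
    intro p
    induction p using MvPolynomial.induction_on with
    | C a =>
      rw [algHom_C, map_C, algebraMap_apply]
      exact aeval_C _ _
    | add p q hp hq => simp only [map_add, hp, hq]
    | mul_X p i hp =>
      rw [map_mul, map_mul, map_mul, hp, map_X]
      congr 1
      simp [τ, κ]
  have hcc : ∀ p, constantCoeff (τ p) = ε p := by
    intro p
    induction p using MvPolynomial.induction_on with
    | C a => rw [algHom_C, algHom_C, algebraMap_apply]; simp
    | add p q hp hq => simp only [map_add, hp, hq]
    | mul_X p i hp => rw [map_mul, map_mul, map_mul, hp]; simp [τ]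
  have hτF : τ F ≠ 0 := by
    intro h
    apply hF
    apply map_injective _ (algebraMap k L).injective
    rw [← hκτ, h, map_zero, map_zero]
  have hdeg : (τ F).totalDegree ≤ r := by
    have hmon : ∀ (v : ι →₀ ℕ) (a : k), a ≠ 0 → (τ (monomial v a)).totalDegree ≤ v.degree := by
      intro v a _
      rw [aeval_monomial, Finsupp.prod]
      refine (totalDegree_mul _ _).trans ?_
      rw [MvPolynomial.algebraMap_apply, totalDegree_C, zero_add]
      refine (totalDegree_finsetProd _ _).trans (Finset.sum_le_sum fun i _ => ?_)
      refine (totalDegree_pow _ _).trans ?_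
      have : (X i + C (ε (X i)) : MvPolynomial ι L).totalDegree ≤ 1 :=
        (totalDegree_add _ _).trans (by simp)
      calc v i * _ ≤ v i * 1 := Nat.mul_le_mul_left _ this
        _ = v i := mul_one _
    rw [F.as_sum, map_sum]
    refine totalDegree_finsetSum_le fun v hv => (hmon v _ (mem_support_iff.mp hv)).trans ?_
    exact (le_totalDegree hv).trans hr
  have hord : ((r + 1 : ℕ) : ℕ∞) ≤ (τ (s * F) : MvPowerSeries ι L).order := by
    have h1 : P.map (τ : MvPolynomial ι k →+* MvPolynomial ι L) ≤ idealOfVars ι L := by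
      rw [Ideal.map_le_iff_le_comap]
      intro p hp
      rw [Ideal.mem_comap, ← pow_one (idealOfVars ι L), mem_pow_idealOfVars_iff']
      intro v hv
      have : v = 0 := (Finsupp.degree_eq_zero_iff v).mp (by omega)
      rw [this]
      exact (hcc p).trans ((hε p).mpr hp)
    have h2 : τ (s * F) ∈ idealOfVars ι L ^ (r + 1) := by
      refine Ideal.pow_right_mono h1 _ ?_
      rw [← Ideal.map_pow]
      exact Ideal.mem_map_of_mem (τ : MvPolynomial ι k →+* MvPolynomial ι L) hmem
    rw [mem_pow_idealOfVars_iff'] at h2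
    exact MvPowerSeries.nat_le_order fun v hv => by rw [coeff_coe]; exact h2 v hv
  -- Order is additive on power series over a field, so a factor with nonzero constant term leaves
  -- it unchanged.
  have hs0 : (τ s : MvPowerSeries ι L).order = 0 := by
    by_contra h
    rw [← ne_eq, MvPowerSeries.order_ne_zero_iff_constCoeff_eq_zero] at h
    apply hs
    rw [← hε, ← hcc]
    exact h
  obtain ⟨v, hv⟩ := ne_zero_iff.mp hτF
  rw [map_mul, coe_mul, MvPowerSeries.order_mul, hs0, zero_add] at hord
  have h1 : (τ F : MvPowerSeries ι L).order ≤ v.degree :=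
    MvPowerSeries.order_le (by rwa [coeff_coe])
  have h2 : v.degree ≤ r := (le_totalDegree (mem_support_iff.mpr hv)).trans hdeg
  have h3 := hord.trans h1
  norm_cast at h3
  omega

/-! ### One quadratic transform: the chart R[𝔪/x] and its exceptional divisor. -/

/-- `x` is a local equation of the exceptional divisor of the local quadratic transform `R₁` of the
regular local ring `R`. -/
structure IsExceptionalParameter {K : Type*} [Field K] (R R₁ : LocalSubring K) (x : R.toSubring)
    (x₁ : R₁.toSubring) : Prop where
  coe_eq : (x₁ : K) = x
  le : R ≤ R₁
  mem : x ∈ maximalIdeal R.toSubring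
  ne_zero : x ≠ 0
  isPrime : (Ideal.span {x₁}).IsPrime
  exists_mul_eq : ∀ a ∈ maximalIdeal R.toSubring, ∃ b : R₁.toSubring, (b : K) * x = a
  exists_fraction : ∀ y : R₁.toSubring, ∃ (a b : R.toSubring) (u : R₁.toSubring) (N : ℕ),
    IsUnit u ∧ (b : K) = (x : K) ^ N * u ∧ (y : K) * b = a
  order_le : ∀ (r : ℕ) (f : R.toSubring) (g : R₁.toSubring), (x : K) ^ r * g = f →
    f ∈ maximalIdeal R.toSubring ^ r → f ∉ maximalIdeal R.toSubring ^ (r + 1) →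
    g ∉ maximalIdeal R₁.toSubring ^ (r + 1) ∧ g ∉ Ideal.span {x₁}

section Dehomogenize

variable {R K : Type*} [CommRing R] [IsLocalRing R] [Field K] [Algebra R K] {x : R} {s : Finset R}

/-- Dehomogenization: an element of 𝔪^r is a form of degree r in x and the yᵢ, and dividing by x^r
replaces x by 1. -/
theorem exists_totalDegree_le_of_mem_maximalIdeal_pow (hxK : algebraMap R K x ≠ 0)
    (hx : maximalIdeal R = Ideal.span (insert x (s : Set R))) (r : ℕ) {f : R}
    (hf : f ∈ maximalIdeal R ^ r) : ∃ G : MvPolynomial s R, G.totalDegree ≤ r ∧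
      algebraMap R K x ^ r *
        MvPolynomial.aeval (fun i : s => algebraMap R K i / algebraMap R K x) G =
          algebraMap R K f := by
  set ψ := MvPolynomial.aeval (R := R) (fun i : s => algebraMap R K i / algebraMap R K x) with hψ
  have hone : ∀ a ∈ maximalIdeal R, ∃ G : MvPolynomial s R, G.totalDegree ≤ 1 ∧
      algebraMap R K x * ψ G = algebraMap R K a := by
    intro a ha
    rw [hx] at ha
    induction ha using Submodule.span_induction with
    | mem a ha =>
      rcases ha with rfl | ha
      · exact ⟨1, by simp, by simp⟩
      · refine ⟨MvPolynomial.X ⟨a, ha⟩, ?_, ?_⟩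
        · exact (MvPolynomial.totalDegree_monomial_le _ _).trans (by simp)
        · rw [hψ, MvPolynomial.aeval_X]; field_simp
    | zero => exact ⟨0, by simp, by simp⟩
    | add a b _ _ ha hb =>
      obtain ⟨F, hF, hF'⟩ := ha
      obtain ⟨G, hG, hG'⟩ := hb
      exact ⟨F + G, (MvPolynomial.totalDegree_add _ _).trans (max_le hF hG), by
        rw [map_add, mul_add, hF', hG', map_add]⟩
    | smul c a _ ha =>
      obtain ⟨F, hF, hF'⟩ := ha
      refine ⟨c • F, (MvPolynomial.totalDegree_smul_le _ _).trans hF, ?_⟩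
      rw [map_smul, mul_smul_comm, hF', smul_eq_mul, map_mul, Algebra.smul_def]
  induction r generalizing f with
  | zero => exact ⟨MvPolynomial.C f, by simp, by simp⟩
  | succ r ih =>
    rw [pow_succ] at hf
    induction hf using Submodule.mul_induction_on' with
    | mem_mul_mem a ha b hb =>
      obtain ⟨F, hF, hF'⟩ := ih ha
      obtain ⟨G, hG, hG'⟩ := hone b hb
      refine ⟨F * G, (MvPolynomial.totalDegree_mul _ _).trans (add_le_add hF hG), ?_⟩
      rw [map_mul, map_mul, ← hF', ← hG']; ring
    | add a _ b _ ha hb =>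
      obtain ⟨F, hF, hF'⟩ := ha
      obtain ⟨G, hG, hG'⟩ := hb
      exact ⟨F + G, (MvPolynomial.totalDegree_add _ _).trans (max_le hF hG), by
        rw [map_add, mul_add, hF', hG', map_add]⟩

/-- Rehomogenizing puts each monomial of G in 𝔪^r, and its coefficient supplies one more factor from
𝔪. -/
theorem mem_maximalIdeal_pow_succ_of_map_residue_eq_zero
    (hinj : Function.Injective (algebraMap R K)) (hxK : algebraMap R K x ≠ 0)
    (hx : maximalIdeal R = Ideal.span (insert x (s : Set R))) {r : ℕ} {f : R}
    {G : MvPolynomial s R} (hdeg : G.totalDegree ≤ r)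
    (hG : MvPolynomial.map (residue R) G = 0)
    (hf : algebraMap R K x ^ r *
      MvPolynomial.aeval (fun i : s => algebraMap R K i / algebraMap R K x) G =
        algebraMap R K f) : f ∈ maximalIdeal R ^ (r + 1) := by
  have hxm : x ∈ maximalIdeal R := hx ▸ Ideal.subset_span (Set.mem_insert _ _)
  have hcoeff : ∀ v, G.coeff v ∈ maximalIdeal R := by
    intro v
    rw [← residue_eq_zero_iff, ← MvPolynomial.coeff_map, hG, MvPolynomial.coeff_zero]
  have key : f = ∑ v ∈ G.support,
      G.coeff v * (x ^ (r - v.degree) * v.prod fun i n => (i : R) ^ n) := by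
    apply hinj
    rw [← hf, MvPolynomial.aeval_def, MvPolynomial.eval₂_eq, Finset.mul_sum, map_sum]
    refine Finset.sum_congr rfl fun v hv => ?_
    have hv' : v.degree ≤ r := (MvPolynomial.le_totalDegree hv).trans hdeg
    have hsplit : algebraMap R K x ^ r =
        algebraMap R K x ^ (r - v.degree) * ∏ i ∈ v.support, algebraMap R K x ^ v i := by
      rw [Finset.prod_pow_eq_pow_sum, ← pow_add]
      congr 1
      change r = r - v.degree + v.degree
      omega
    rw [hsplit, map_mul, map_mul, map_pow, Finsupp.prod, map_prod]
    simp only [div_pow, map_pow, Finset.prod_div_distrib]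
    have hne : ∏ i ∈ v.support, algebraMap R K x ^ v i ≠ 0 :=
      Finset.prod_ne_zero_iff.mpr fun i _ => pow_ne_zero _ hxK
    field_simp
  rw [key]
  refine Ideal.sum_mem _ fun v hv => ?_
  have hv' : v.degree ≤ r := (MvPolynomial.le_totalDegree hv).trans hdeg
  rw [pow_succ']
  refine Ideal.mul_mem_mul (hcoeff v) ?_
  have hsplit : maximalIdeal R ^ r = maximalIdeal R ^ (r - v.degree) * maximalIdeal R ^ v.degree := by
    rw [← pow_add]; congr 1; omega
  rw [hsplit]
  refine Ideal.mul_mem_mul (Ideal.pow_mem_pow hxm _) ?_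
  rw [show v.degree = ∑ i ∈ v.support, v i from rfl, ← Finset.prod_pow_eq_pow_sum]
  refine Ideal.prod_mem_prod fun i _ => Ideal.pow_mem_pow ?_ _
  rw [hx]
  exact Ideal.subset_span (Set.mem_insert_of_mem _ i.2)

end Dehomogenize

theorem range_aeval_div_eq_blowupChart {K : Type*} [Field K] (R : LocalSubring K)
    {x : R.toSubring} {s : Finset R.toSubring} (hx0 : (x : K) ≠ 0)
    (hx : maximalIdeal R.toSubring = Ideal.span (insert x (s : Set R.toSubring))) :
    (MvPolynomial.aeval (R := R.toSubring)
      (fun i : s => ((i : R.toSubring) : K) / (x : K))).toRingHom.range = blowupChart R x := by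
  set ψ := MvPolynomial.aeval (R := R.toSubring) (fun i : s => ((i : R.toSubring) : K) / (x : K))
    with hψ
  have hC : ∀ a : R.toSubring, ψ (MvPolynomial.C a) = a := fun a => MvPolynomial.algHom_C _ _
  apply le_antisymm
  · rintro _ ⟨G, rfl⟩
    change ψ G ∈ _
    induction G using MvPolynomial.induction_on with
    | C a => rw [hC]; exact le_blowupChart R x a.2
    | add p q hp hq => rw [map_add]; exact add_mem hp hq
    | mul_X p i hp =>
      rw [map_mul]
      refine mul_mem hp (Subring.subset_closure (Or.inr ⟨i, ?_, ?_⟩))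
      · rw [hx]; exact Ideal.subset_span (Set.mem_insert_of_mem _ i.2)
      · rw [hψ, MvPolynomial.aeval_X]
  · refine Subring.closure_le.mpr ?_
    rintro y (hy | ⟨a, ha, rfl⟩)
    · exact ⟨MvPolynomial.C ⟨y, hy⟩, hC ⟨y, hy⟩⟩
    · obtain ⟨G, -, hG⟩ := exists_totalDegree_le_of_mem_maximalIdeal_pow (K := K) hx0 hx 1
        (by rwa [pow_one])
      refine ⟨G, ?_⟩
      change ψ G = _
      rw [eq_div_iff hx0, mul_comm, ← pow_one (x : K)]
      exact hG

theorem MvPolynomial.totalDegree_map_le {A B ι : Type*} [CommSemiring A] [CommSemiring B]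
    (f : A →+* B) (p : MvPolynomial ι A) : (map f p).totalDegree ≤ p.totalDegree :=
  Finset.sup_mono (support_map_subset f p)

/-- `R[𝔪/x]/(x)` is a polynomial ring over the residue field. -/
theorem exists_surjective_blowupChart_to_mvPolynomial {K : Type*} [Field K] (R : LocalSubring K)
    [IsNoetherianRing R.toSubring] {x : R.toSubring} {s : Finset R.toSubring} (hx0 : (x : K) ≠ 0)
    (hx : maximalIdeal R.toSubring = Ideal.span (insert x (s : Set R.toSubring)))
    (hd : ((s.card + 1 : ℕ) : WithBot ℕ∞) ≤ ringKrullDim R.toSubring) :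
    ∃ (φ : MvPolynomial s R.toSubring →+* blowupChart R x)
      (π : blowupChart R x →+* MvPolynomial s (ResidueField R.toSubring)),
      Function.Surjective φ ∧ Function.Surjective π ∧
      (∀ G, (φ G : K) = MvPolynomial.aeval (R := R.toSubring)
        (fun i : s => ((i : R.toSubring) : K) / (x : K)) G) ∧
      (∀ G, π (φ G) = MvPolynomial.map (residue R.toSubring) G) ∧
      RingHom.ker π = Ideal.span {Subring.inclusion (le_blowupChart R x) x} := by
  set ψ := MvPolynomial.aeval (R := R.toSubring) (fun i : s => ((i : R.toSubring) : K) / (x : K))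
    with hψ
  have hrange := range_aeval_div_eq_blowupChart R hx0 hx
  have hmem : ∀ G, ψ G ∈ blowupChart R x := fun G => hrange ▸ ⟨G, rfl⟩
  let φ : MvPolynomial s R.toSubring →+* blowupChart R x := ψ.toRingHom.codRestrict _ hmem
  have hφval : ∀ G, (φ G : K) = ψ G := fun G => rfl
  have hφ : Function.Surjective φ := by
    rintro ⟨y, hy⟩
    obtain ⟨G, hG⟩ : y ∈ ψ.toRingHom.range := hrange.symm ▸ hy
    exact ⟨G, Subtype.ext hG⟩
  set ρ : MvPolynomial s R.toSubring →+* MvPolynomial s (ResidueField R.toSubring) :=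
    MvPolynomial.map (residue R.toSubring) with hρ
  have hinj : Function.Injective (algebraMap R.toSubring K) := Subtype.val_injective
  have hker : RingHom.ker φ ≤ RingHom.ker ρ := by
    intro G hG
    refine map_residue_eq_zero_of_aeval_div_eq_zero hinj (fun h => hx0 (by rw [h]; rfl)) hx hd ?_
    exact congrArg Subtype.val ((RingHom.mem_ker).mp hG)
  -- Reduction of coefficients descends to the chart because relations among the yᵢ/x have all
  -- coefficients in 𝔪.
  let π : blowupChart R x →+* MvPolynomial s (ResidueField R.toSubring) :=
    RingHom.liftOfSurjective φ hφ ⟨ρ, hker⟩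
  have hπ : ∀ G, π (φ G) = ρ G := fun G =>
    RingHom.liftOfRightInverse_comp_apply φ _ (Function.rightInverse_surjInv hφ) ⟨ρ, hker⟩ G
  have hρs : Function.Surjective ρ := MvPolynomial.map_surjective _ residue_surjective
  have hφC : ∀ a, φ (MvPolynomial.C a) = Subring.inclusion (le_blowupChart R x) a := fun a =>
    Subtype.ext (MvPolynomial.algHom_C ψ a)
  refine ⟨φ, π, hφ, fun p => ?_, hφval, hπ, le_antisymm ?_ ?_⟩
  · obtain ⟨G, rfl⟩ := hρs p
    exact ⟨φ G, hπ G⟩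
  · intro y hy
    obtain ⟨G, rfl⟩ := hφ y
    have hG : G ∈ (maximalIdeal R.toSubring).map
        (MvPolynomial.C : R.toSubring →+* MvPolynomial s R.toSubring) := by
      rw [← IsLocalRing.ker_residue, ← MvPolynomial.ker_map, RingHom.mem_ker]
      exact (hπ G).symm.trans hy
    have hle : (maximalIdeal R.toSubring).map
        (MvPolynomial.C : R.toSubring →+* MvPolynomial s R.toSubring) ≤
        (Ideal.span {Subring.inclusion (le_blowupChart R x) x}).comap φ := by
      rw [Ideal.map_le_iff_le_comap]
      intro a ha
      rw [Ideal.mem_comap, Ideal.mem_comap, hφC, Ideal.mem_span_singleton']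
      refine ⟨⟨(a : K) / x, Subring.subset_closure (Or.inr ⟨a, ha, rfl⟩)⟩, Subtype.ext ?_⟩
      exact div_mul_cancel₀ _ hx0
    exact hle hG
  · rw [Ideal.span_singleton_le_iff_mem, RingHom.mem_ker, ← hφC, hπ, hρ, MvPolynomial.map_C,
      (residue_eq_zero_iff x).mpr (hx ▸ Ideal.subset_span (Set.mem_insert _ _)), map_zero]

theorem LocalSubring.le_ofPrime_of_map_le {K : Type*} [Field K] {R : LocalSubring K} {A : Subring K}
    (h : R.toSubring ≤ A) (𝔭 : Ideal A) [𝔭.IsPrime]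
    (h𝔭 : (maximalIdeal R.toSubring).map (Subring.inclusion h) ≤ 𝔭) :
    R ≤ LocalSubring.ofPrime A 𝔭 := by
  refine ⟨h.trans (LocalSubring.le_ofPrime A 𝔭), ⟨fun a ha => ?_⟩⟩
  by_contra hna
  have h1 : Subring.inclusion h a ∈ 𝔭 := h𝔭 (Ideal.mem_map_of_mem _ ((mem_maximalIdeal a).mpr hna))
  have h2 := (IsLocalization.AtPrime.to_map_mem_maximal_iff
    (LocalSubring.ofPrime A 𝔭).toSubring 𝔭 (Subring.inclusion h a)).mpr h1
  exact (mem_maximalIdeal _).mp h2 ha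

-- R₁/(x) is the localization of a polynomial ring over a field at a prime, hence a regular domain;
-- this gives regularity of R₁ and primality of x. Orders in R₁ are bounded by orders of images in
-- this quotient.
set_option maxHeartbeats 400000 in
theorem IsLocalQuadraticTransform.exists_isExceptionalParameter {K : Type*} [Field K]
    {R R₁ : LocalSubring K} (hR : IsRegularLocalRing R.toSubring)
    (h : IsLocalQuadraticTransform R R₁) :
    IsRegularLocalRing R₁.toSubring ∧ ∃ x x₁, IsExceptionalParameter R R₁ x x₁ := by
  obtain ⟨x, hxm, hx2, 𝔭, h𝔭, hle, rfl⟩ := h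
  obtain ⟨s, hx, hd⟩ := IsRegularLocalRing.exists_finset_maximalIdeal_eq_span_insert hxm hx2
  have hx0 : x ≠ 0 := by rintro rfl; exact hx2 (Ideal.zero_mem _)
  have hx0K : (x : K) ≠ 0 := fun h => hx0 (Subtype.ext h)
  obtain ⟨φ, π, hφ, hπ, hφval, hπφ, hkerπ⟩ :=
    exists_surjective_blowupChart_to_mvPolynomial R hx0K hx hd
  let A := blowupChart R x
  let R₁ := (LocalSubring.ofPrime A 𝔭).toSubring
  let xA : A := Subring.inclusion (le_blowupChart R x) x
  have hker𝔭 : RingHom.ker π ≤ 𝔭 := by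
    rw [hkerπ, Ideal.span_singleton_le_iff_mem]
    exact hle (Ideal.mem_map_of_mem _ hxm)
  set P := 𝔭.map π with hP
  have hPp : P.IsPrime := Ideal.map_isPrime_of_surjective hπ hker𝔭
  have hcomap : ∀ a, π a ∈ P ↔ a ∈ 𝔭 := by
    intro a
    rw [← Ideal.mem_comap, hP, Ideal.comap_map_of_surjective' π hπ, sup_eq_left.mpr hker𝔭]
  have hT : Submonoid.map π 𝔭.primeCompl = P.primeCompl := by
    ext b
    obtain ⟨a, rfl⟩ := hπ b
    constructor
    · rintro ⟨a', ha', haa⟩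
      rw [← haa]
      exact fun hmem => ha' ((hcomap a').mp hmem)
    · intro ha
      exact ⟨a, fun hmem => ha ((hcomap a).mpr hmem), rfl⟩
  let B := Localization.AtPrime P
  have hB : IsRegularLocalRing B := IsRegularRing.isRegularLocalRing_localization P
  have hBloc : IsLocalization (Submonoid.map π 𝔭.primeCompl) B := by rw [hT]; infer_instance
  let Φ : R₁ →+* B := IsLocalization.map B π (hT.symm ▸ 𝔭.primeCompl.le_comap_map)
  have hΦ : ∀ a : A, Φ (algebraMap A R₁ a) = algebraMap _ B (π a) := fun a =>
    IsLocalization.map_eq _ a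
  have hΦs : Function.Surjective Φ := by
    intro b
    obtain ⟨p, q, rfl⟩ := IsLocalization.exists_mk'_eq P.primeCompl b
    obtain ⟨a, rfl⟩ := hπ p
    obtain ⟨t, ht⟩ := hπ q
    have ht𝔭 : t ∈ 𝔭.primeCompl := fun hmem => q.2 (ht ▸ (hcomap t).mpr hmem)
    refine ⟨IsLocalization.mk' R₁ a ⟨t, ht𝔭⟩, ?_⟩
    rw [IsLocalization.map_mk']
    congr 1
    exact Subtype.ext ht
  have hkerΦ : RingHom.ker Φ = Ideal.span {algebraMap A R₁ xA} := by
    have h1 := IsLocalization.ker_map (S := R₁) B π hT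
    rw [hkerπ, Ideal.map_span, Set.image_singleton] at h1
    exact h1
  have hNA : IsNoetherianRing A := isNoetherianRing_of_surjective _ _ φ hφ
  have hNR₁ : IsNoetherianRing R₁ := IsLocalization.isNoetherianRing 𝔭.primeCompl R₁ hNA
  have hx₁0 : algebraMap A R₁ xA ≠ 0 := fun h => hx0K (congrArg Subtype.val h)
  have hBdom : IsDomain B := inferInstance
  refine ⟨IsRegularLocalRing.of_surjective_of_ker_eq_span_singleton Φ hΦs hx₁0 hkerΦ,
    x, algebraMap A R₁ xA, rfl, LocalSubring.le_ofPrime_of_map_le _ 𝔭 hle, hxm, hx0, ?_, ?_, ?_, ?_⟩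
  · rw [← hkerΦ]; exact RingHom.ker_isPrime Φ
  · intro a ha
    refine ⟨algebraMap A R₁ ⟨(a : K) / x, Subring.subset_closure (Or.inr ⟨a, ha, rfl⟩)⟩, ?_⟩
    exact div_mul_cancel₀ _ hx0K
  · have hfrac : ∀ a : A, ∃ (N : ℕ) (c : R.toSubring), (x : K) ^ N * a = c := by
      intro a
      obtain ⟨G, rfl⟩ := hφ a
      obtain ⟨N, c, hc⟩ := MvPolynomial.exists_C_pow_mul_sub_C_mem_span x
        (fun i : s => (i : R.toSubring)) G
      refine ⟨N, c, ?_⟩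
      set ψ := MvPolynomial.aeval (R := R.toSubring)
        (fun i : s => ((i : R.toSubring) : K) / (x : K)) with hψ
      have hψC : ∀ a : R.toSubring, ψ (MvPolynomial.C a) = a := fun a => MvPolynomial.algHom_C _ _
      have hu0 : Ideal.span (Set.range fun i : s => MvPolynomial.C x * MvPolynomial.X i -
          MvPolynomial.C (i : R.toSubring)) ≤ RingHom.ker ψ := by
        rw [Ideal.span_le]
        rintro _ ⟨i, rfl⟩
        rw [SetLike.mem_coe, RingHom.mem_ker, map_sub, map_mul, hψC, hψC, hψ,
          MvPolynomial.aeval_X, mul_div_cancel₀ _ hx0K, sub_self]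
      have h1 := hu0 hc
      rw [RingHom.mem_ker, map_sub, map_mul, map_pow, hψC, hψC, sub_eq_zero] at h1
      rw [hφval]; exact h1
    intro y
    obtain ⟨⟨a, t⟩, hat⟩ := IsLocalization.surj 𝔭.primeCompl y
    obtain ⟨N, c, hc⟩ := hfrac a
    obtain ⟨M, d, hd⟩ := hfrac t
    refine ⟨x ^ M * c, x ^ N * d, algebraMap A R₁ t, N + M,
      IsLocalization.map_units R₁ t, ?_, ?_⟩
    · push_cast
      rw [← hd, pow_add, mul_assoc]; rfl
    · push_cast
      rw [← hd, ← hc]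
      have h1 : (y : K) * (t : A) = (a : A) := congrArg Subtype.val hat
      rw [← h1]; ring
  · intro r f g hgf hf hf'
    obtain ⟨G, hdeg, hG⟩ := exists_totalDegree_le_of_mem_maximalIdeal_pow (K := K) hx0K hx r hf
    have hg : g = algebraMap A R₁ (φ G) := by
      apply Subtype.ext
      have h1 : (algebraMap A R₁ (φ G) : K) = (φ G : K) := rfl
      rw [h1, hφval]
      exact mul_left_cancel₀ (pow_ne_zero r hx0K) (hgf.trans hG.symm)
    -- Order exactly r means that the dehomogenization survives modulo 𝔪.
    have hρ : MvPolynomial.map (residue R.toSubring) G ≠ 0 := fun h0 => hf'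
      (mem_maximalIdeal_pow_succ_of_map_residue_eq_zero (K := K) Subtype.val_injective hx0K hx
        hdeg h0 hG)
    have hdeg' : (MvPolynomial.map (residue R.toSubring) G).totalDegree ≤ r :=
      (MvPolynomial.totalDegree_map_le _ _).trans hdeg
    have hmain : Φ g ∉ maximalIdeal B ^ (r + 1) := by
      rw [hg, hΦ, hπφ, ← Localization.AtPrime.map_eq_maximalIdeal, ← Ideal.map_pow,
        IsLocalization.algebraMap_mem_map_algebraMap_iff P.primeCompl]
      rintro ⟨t, ht, htG⟩
      exact MvPolynomial.mul_notMem_pow_of_totalDegree_le hρ hdeg' ht htG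
    constructor
    · intro hmem
      apply hmain
      have h1 := Ideal.mem_map_of_mem Φ hmem
      rwa [Ideal.map_pow, IsLocalRing.map_maximalIdeal_of_surjective Φ hΦs] at h1
    · intro hmem
      apply hmain
      rw [← hkerΦ, RingHom.mem_ker] at hmem
      rw [hmem]
      exact Ideal.zero_mem _

/-! ### Localizations inside K and strict transforms. -/

theorem LocalSubring.mem_ofPrime_iff {K : Type*} [Field K] {A : Subring K} (q : Ideal A) [q.IsPrime]
    {y : K} : y ∈ (LocalSubring.ofPrime A q).toSubring ↔ ∃ a b : A, b ∉ q ∧ y * b = a := by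
  constructor
  · intro hy
    obtain ⟨⟨a, b⟩, hab⟩ := IsLocalization.surj q.primeCompl
      (⟨y, hy⟩ : (LocalSubring.ofPrime A q).toSubring)
    exact ⟨a, b, b.2, congrArg Subtype.val hab⟩
  · rintro ⟨a, b, hb, hab⟩
    obtain ⟨u, hu⟩ := IsLocalization.map_units (LocalSubring.ofPrime A q).toSubring
      (⟨b, hb⟩ : q.primeCompl)
    have hu1 : ((u : (LocalSubring.ofPrime A q).toSubring) : K) = b := congrArg Subtype.val hu
    have hu2 : (b : K) * ((u⁻¹ : _ˣ) : (LocalSubring.ofPrime A q).toSubring) = 1 := by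
      rw [← hu1]; exact congrArg Subtype.val u.mul_inv
    have : y = (a : K) * ((u⁻¹ : _ˣ) : (LocalSubring.ofPrime A q).toSubring) := by
      rw [← hab, mul_assoc, hu2, mul_one]
    rw [this]
    exact mul_mem (LocalSubring.le_ofPrime A q a.2) (Subtype.mem _)

theorem LocalSubring.ofPrime_anti {K : Type*} [Field K] {A : Subring K} {p q : Ideal A}
    [p.IsPrime] [q.IsPrime] (h : p ≤ q) :
    (LocalSubring.ofPrime A q).toSubring ≤ (LocalSubring.ofPrime A p).toSubring := by
  intro y hy
  obtain ⟨a, b, hb, hab⟩ := (mem_ofPrime_iff q).mp hy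
  exact (mem_ofPrime_iff p).mpr ⟨a, b, fun hbp => hb (h hbp), hab⟩

theorem LocalSubring.ringKrullDim_ofPrime {K : Type*} [Field K] {A : Subring K} (q : Ideal A)
    [q.IsPrime] : ringKrullDim (LocalSubring.ofPrime A q).toSubring = q.height :=
  IsLocalization.AtPrime.ringKrullDim_eq_height q _

namespace IsExceptionalParameter

variable {K : Type*} [Field K] {R R₁ : LocalSubring K} {x : R.toSubring} {x₁ : R₁.toSubring}

/-- The transform is an isomorphism off the exceptional divisor: elements of R₁ are fractions over R
with denominator a power of x times a unit of R₁, which avoids q. -/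
theorem ofPrime_comap_eq (h : IsExceptionalParameter R R₁ x x₁) (q : Ideal R₁.toSubring)
    [q.IsPrime] (hx : x₁ ∉ q) :
    (LocalSubring.ofPrime R.toSubring (q.comap (Subring.inclusion h.le.1))).toSubring =
      (LocalSubring.ofPrime R₁.toSubring q).toSubring := by
  apply le_antisymm
  · intro y hy
    obtain ⟨a, b, hb, hab⟩ := (LocalSubring.mem_ofPrime_iff _).mp hy
    exact (LocalSubring.mem_ofPrime_iff _).mpr
      ⟨Subring.inclusion h.le.1 a, Subring.inclusion h.le.1 b, hb, hab⟩
  · have hq : ∀ (b : R.toSubring) (u : R₁.toSubring) (N : ℕ), IsUnit u →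
        (b : K) = (x : K) ^ N * u → Subring.inclusion h.le.1 b ∉ q := by
      intro b u N hu hb hbq
      have : Subring.inclusion h.le.1 b = x₁ ^ N * u := Subtype.ext (by
        push_cast; rw [h.coe_eq]; exact hb)
      rw [this] at hbq
      rcases ‹q.IsPrime›.mem_or_mem hbq with h1 | h1
      · exact hx (‹q.IsPrime›.mem_of_pow_mem N h1)
      · exact ‹q.IsPrime›.ne_top (Ideal.eq_top_of_isUnit_mem _ h1 hu)
    intro y hy
    obtain ⟨c, d, hd, hcd⟩ := (LocalSubring.mem_ofPrime_iff _).mp hy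
    obtain ⟨a, b, u, N, hu, hb, hcb⟩ := h.exists_fraction c
    obtain ⟨a', b', u', N', hu', hb', hdb⟩ := h.exists_fraction d
    refine (LocalSubring.mem_ofPrime_iff _).mpr ⟨a * b', a' * b, ?_, ?_⟩
    · intro hmem
      have : Subring.inclusion h.le.1 (a' * b) =
          d * (Subring.inclusion h.le.1 b' * Subring.inclusion h.le.1 b) := Subtype.ext (by
        push_cast; rw [← mul_assoc]
        change (a' : K) * b = d * b' * b
        rw [hdb])
      rw [Ideal.mem_comap, this] at hmem
      rcases ‹q.IsPrime›.mem_or_mem hmem with h1 | h1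
      · exact hd h1
      · rcases ‹q.IsPrime›.mem_or_mem h1 with h1 | h1
        · exact hq b' u' N' hu' hb' h1
        · exact hq b u N hu hb h1
    · push_cast
      rw [← hcb, ← hdb, ← hcd]; ring

theorem exists_pow_mul_eq (h : IsExceptionalParameter R R₁ x x₁) (r : ℕ) {f : R.toSubring}
    (hf : f ∈ maximalIdeal R.toSubring ^ r) : ∃ g : R₁.toSubring, (x : K) ^ r * g = f := by
  induction r generalizing f with
  | zero => exact ⟨Subring.inclusion h.le.1 f, by simp⟩
  | succ r ih =>
    rw [pow_succ] at hf
    induction hf using Submodule.mul_induction_on' with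
    | mem_mul_mem a ha b hb =>
      obtain ⟨c, hc⟩ := ih ha
      obtain ⟨d, hd⟩ := h.exists_mul_eq b hb
      refine ⟨c * d, ?_⟩
      push_cast
      rw [← hc, ← hd]; ring
    | add a _ b _ ha hb =>
      obtain ⟨c, hc⟩ := ha
      obtain ⟨d, hd⟩ := hb
      exact ⟨c + d, by push_cast; rw [mul_add, hc, hd]⟩

end IsExceptionalParameter

theorem Ideal.eq_of_le_of_height_eq_one {A : Type*} [CommRing A] [IsDomain A] [IsNoetherianRing A]
    {p q : Ideal A} [hp : p.IsPrime] [q.IsPrime] (hp0 : p ≠ ⊥) (hpq : p ≤ q) (hq : q.height = 1) :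
    p = q := by
  by_contra hne
  have h1 : p.height + 1 ≤ q.height :=
    Ideal.height_add_one_le_of_lt_of_isPrime (lt_of_le_of_ne hpq hne)
  have h2 : (⊥ : Ideal A).height + 1 ≤ p.height :=
    Ideal.height_add_one_le_of_lt_of_isPrime (bot_lt_iff_ne_bot.mpr hp0)
  rw [hq] at h1
  have h3 : (1 : ℕ∞) + 1 ≤ 1 := (add_le_add_left (le_add_self.trans h2) 1).trans h1
  exact absurd h3 (by decide)

theorem Ideal.height_eq_one_of_mem_minimalPrimes_span_singleton {A : Type*} [CommRing A]
    [IsDomain A] [IsNoetherianRing A] {a : A} (ha : a ≠ 0) {p : Ideal A}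
    (hp : p ∈ (Ideal.span {a}).minimalPrimes) : p.height = 1 := by
  have hprime : p.IsPrime := hp.1.1
  refine le_antisymm ?_ ?_
  · have : (Ideal.span {a}).IsPrincipal := ⟨a, rfl⟩
    exact Ideal.height_le_one_of_isPrincipal_of_mem_minimalPrimes _ p hp
  · have hp0 : p ≠ ⊥ := by
      rintro rfl
      exact ha (by simpa using hp.1.2 (Ideal.mem_span_singleton_self a))
    exact le_add_self.trans
      (Ideal.height_add_one_le_of_lt_of_isPrime (bot_lt_iff_ne_bot.mpr hp0))

/-- If all strict transforms of a nonzero element stay in the maximal ideals, then the sequence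
does not switch strongly infinitely often. -/
theorem exists_height_one_of_strictTransform_mem {K : Type*} [Field K] {R : ℕ → LocalSubring K}
    (hreg : ∀ n, IsRegularLocalRing (R n).toSubring) {x : ∀ n, (R n).toSubring}
    {x₁ : ∀ n, (R (n + 1)).toSubring}
    (hE : ∀ n, IsExceptionalParameter (R n) (R (n + 1)) (x n) (x₁ n)) {r : ℕ}
    (g : ∀ n, (R n).toSubring) (hg0 : g 0 ≠ 0) (hgm : ∀ n, g n ∈ maximalIdeal (R n).toSubring)
    (hg : ∀ n, (x n : K) ^ r * g (n + 1) = g n) (hgx : ∀ n, g (n + 1) ∉ Ideal.span {x₁ n}) :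
    ∃ (𝔭 : Ideal (R 0).toSubring) (_ : 𝔭.IsPrime), 𝔭.height = 1 ∧
      ∀ n, (R n).toSubring ≤ (LocalSubring.ofPrime (R 0).toSubring 𝔭).toSubring := by
  have hmono : Monotone R := monotone_nat_of_le_succ fun n => (hE n).le
  have hgn0 : ∀ n, g n ≠ 0 := by
    intro n
    induction n with
    | zero => exact hg0
    | succ n ih =>
      intro h
      apply ih
      apply Subtype.ext
      rw [← hg n, h]; simp
  have hdesc : ∀ (m : ℕ) (q : Ideal (R m).toSubring) (_ : q.IsPrime), q.height = 1 → g m ∈ q →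
      ∃ (p : Ideal (R 0).toSubring) (_ : p.IsPrime), p.height = 1 ∧ g 0 ∈ p ∧
        (LocalSubring.ofPrime (R 0).toSubring p).toSubring =
          (LocalSubring.ofPrime (R m).toSubring q).toSubring := by
    intro m
    induction m with
    | zero => exact fun q hq h1 hgq => ⟨q, hq, h1, hgq, rfl⟩
    | succ m ih =>
      intro q hq h1 hgq
      -- Otherwise the height one prime q would equal (x₁), and the strict transform would be
      -- divisible by x₁.
      have hxq : x₁ m ∉ q := by
        intro hmem
        have := (hE m).isPrime
        have hne : Ideal.span {x₁ m} ≠ ⊥ := by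
          rw [Ne, Ideal.span_singleton_eq_bot]
          intro h0
          apply (hE m).ne_zero
          apply Subtype.ext
          rw [← (hE m).coe_eq, h0]; rfl
        have heq := Ideal.eq_of_le_of_height_eq_one hne
          ((Ideal.span_singleton_le_iff_mem _).mpr hmem) h1
        exact hgx m (heq ▸ hgq)
      have hloc := (hE m).ofPrime_comap_eq q hxq
      have hht : (q.comap (Subring.inclusion (hE m).le.1)).height = 1 := by
        have := LocalSubring.ringKrullDim_ofPrime (q.comap (Subring.inclusion (hE m).le.1))
        rw [hloc, LocalSubring.ringKrullDim_ofPrime, h1] at this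
        exact_mod_cast this.symm
      obtain ⟨p, hp, hp1, hgp, hpeq⟩ := ih _ inferInstance hht (by
        rw [Ideal.mem_comap]
        have : Subring.inclusion (hE m).le.1 (g m) = x₁ m ^ r * g (m + 1) := Subtype.ext (by
          push_cast; rw [(hE m).coe_eq, hg m]; rfl)
        rw [this]
        exact Ideal.mul_mem_left _ _ hgq)
      exact ⟨p, hp, hp1, hgp, hpeq.trans hloc⟩
  have hfin : (Ideal.span {g 0}).minimalPrimes.Finite :=
    Ideal.finite_minimalPrimes_of_isNoetherianRing _ _
  by_contra! hcon
  -- Only the finitely many minimal primes of g₀ matter, so one index M defeats them all; yet a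
  -- minimal prime of the strict transform in R_M contracts to one of them with the same
  -- localization.
  have hcon' : ∀ p : Ideal (R 0).toSubring, ∃ n, ∀ _ : p.IsPrime, p.height = 1 →
      ¬ (R n).toSubring ≤ (LocalSubring.ofPrime (R 0).toSubring p).toSubring := by
    intro p
    by_cases hp : ∃ _ : p.IsPrime, p.height = 1
    · obtain ⟨hp, h1⟩ := hp
      obtain ⟨n, hn⟩ := hcon p hp h1
      exact ⟨n, fun _ _ => hn⟩
    · exact ⟨0, fun h h1 => absurd ⟨h, h1⟩ hp⟩
  choose ν hν using hcon'
  obtain ⟨M, hM⟩ := (hfin.image ν).bddAbove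
  have hne : Ideal.span {g M} ≠ ⊤ := by
    rw [Ne, Ideal.span_singleton_eq_top]
    exact (mem_maximalIdeal _).mp (hgm M)
  obtain ⟨q, hq⟩ := Ideal.nonempty_minimalPrimes hne
  obtain ⟨p, hp, hp1, hgp, hpeq⟩ := hdesc M q hq.1.1
    (Ideal.height_eq_one_of_mem_minimalPrimes_span_singleton (hgn0 M) hq)
    (hq.1.2 (Ideal.mem_span_singleton_self _))
  have hpmin : p ∈ (Ideal.span {g 0}).minimalPrimes := by
    obtain ⟨p', hp', hle⟩ := Ideal.exists_minimalPrimes_le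
      ((Ideal.span_singleton_le_iff_mem p).mpr hgp)
    have := hp'.1.1
    have hne : p' ≠ ⊥ := by
      rintro rfl
      exact hg0 (by simpa using hp'.1.2 (Ideal.mem_span_singleton_self _))
    rwa [Ideal.eq_of_le_of_height_eq_one hne hle hp1] at hp'
  refine hν p hp hp1 ?_
  rw [hpeq]
  have := hq.1.1
  exact (hmono (hM (Set.mem_image_of_mem ν hpmin))).1.trans (LocalSubring.le_ofPrime _ q)

/-! ### The union is a valuation ring of rank one. -/

/-- The least power of the maximal ideal that does not contain both of two elements. -/
theorem IsLocalRing.exists_le_order {A : Type*} [CommRing A] [IsLocalRing A] {f g : A} {n : ℕ}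
    (h : ¬ (f ∈ maximalIdeal A ^ n ∧ g ∈ maximalIdeal A ^ n)) :
    ∃ r < n, f ∈ maximalIdeal A ^ r ∧ g ∈ maximalIdeal A ^ r ∧
      (f ∉ maximalIdeal A ^ (r + 1) ∨ g ∉ maximalIdeal A ^ (r + 1)) := by
  induction n with
  | zero => exact absurd ⟨by simp, by simp⟩ h
  | succ n ih =>
    by_cases hn : f ∈ maximalIdeal A ^ n ∧ g ∈ maximalIdeal A ^ n
    · exact ⟨n, Nat.lt_succ_self n, hn.1, hn.2, not_and_or.mp h⟩
    · obtain ⟨r, hr, h⟩ := ih hn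
      exact ⟨r, hr.trans (Nat.lt_succ_self n), h⟩

section QuadraticSequence

variable {K : Type*} [Field K] {R : ℕ → LocalSubring K} {x : ∀ n, (R n).toSubring}
  {x₁ : ∀ n, (R (n + 1)).toSubring}

/-- Strong induction on the smaller order r. Either this order drops after some transform, or it
stays positive forever and strong switching is contradicted. -/
theorem div_mem_iUnion_or_div_mem_iUnion (hreg : ∀ n, IsRegularLocalRing (R n).toSubring)
    (hE : ∀ n, IsExceptionalParameter (R n) (R (n + 1)) (x n) (x₁ n))
    (hswitch : SwitchesStronglyInfinitelyOften R) (r : ℕ) :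
    ∀ (n : ℕ) (f g : (R n).toSubring), f ∈ maximalIdeal (R n).toSubring ^ r →
      g ∈ maximalIdeal (R n).toSubring ^ r → g ∉ maximalIdeal (R n).toSubring ^ (r + 1) →
      (f : K) / g ∈ ⋃ n, ((R n).toSubring : Set K) ∨ (g : K) / f ∈ ⋃ n, ((R n).toSubring : Set K) := by
  have hmono : Monotone R := monotone_nat_of_le_succ fun n => (hE n).le
  induction r using Nat.strong_induction_on with
  | _ r ih =>
  intro n f g hf hg hg'
  by_contra hcon
  rcases Nat.eq_zero_or_pos r with rfl | hr
  · rw [zero_add, pow_one] at hg'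
    have hu : IsUnit g := by
      by_contra h; exact hg' ((mem_maximalIdeal g).mpr h)
    obtain ⟨v, hv⟩ := hu.exists_right_inv
    have hv' : (g : K) * v = 1 := congrArg Subtype.val hv
    have hg0 : (g : K) ≠ 0 := left_ne_zero_of_mul_eq_one hv'
    refine hcon (Or.inl (Set.mem_iUnion.mpr ⟨n, ?_⟩))
    have : (f : K) / g = (f * v : (R n).toSubring) := by
      push_cast; rw [div_eq_iff hg0, mul_assoc, mul_comm (v : K), hv', mul_one]
    rw [this]
    exact Subtype.mem _
  have hg0 : g ≠ 0 := by rintro rfl; exact hg' (Ideal.zero_mem _)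
  -- Pairs with the original quotient whose smaller order is still r, attained by the second entry.
  let T : ℕ → Type _ := fun k => {p : (R (n + k)).toSubring × (R (n + k)).toSubring //
    p.1 ∈ maximalIdeal (R (n + k)).toSubring ^ r ∧ p.2 ∈ maximalIdeal (R (n + k)).toSubring ^ r ∧
    p.2 ∉ maximalIdeal (R (n + k)).toSubring ^ (r + 1) ∧ (p.1 : K) / p.2 = f / g}
  have hstep : ∀ k (t : T k), ∃ t' : T (k + 1),
      (x (n + k) : K) ^ r * t'.1.2 = t.1.2 ∧ t'.1.2 ∉ Ideal.span {x₁ (n + k)} := by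
    rintro k ⟨⟨a, b⟩, ha, hb, hb', hab⟩
    obtain ⟨a', ha'⟩ := (hE (n + k)).exists_pow_mul_eq r ha
    obtain ⟨b', hbb⟩ := (hE (n + k)).exists_pow_mul_eq r hb
    obtain ⟨ho, hx⟩ := (hE (n + k)).order_le r b b' hbb hb hb'
    have hxr : (x (n + k) : K) ^ r ≠ 0 :=
      pow_ne_zero _ fun h => (hE (n + k)).ne_zero (Subtype.ext h)
    have hdiv : (a' : K) / b' = f / g := by
      rw [← hab]
      change (a' : K) / b' = a / b
      rw [← ha', ← hbb, mul_div_mul_left _ _ hxr]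
    have hdiv' : (b' : K) / a' = g / f := by rw [← inv_div, hdiv, inv_div]
    by_cases hin : a' ∈ maximalIdeal (R (n + k + 1)).toSubring ^ r ∧
        b' ∈ maximalIdeal (R (n + k + 1)).toSubring ^ r
    · exact ⟨⟨(a', b'), hin.1, hin.2, ho, hdiv⟩, hbb, hx⟩
    · exfalso
      apply hcon
      obtain ⟨r', hr', h1, h2, h3 | h3⟩ := exists_le_order hin
      · rw [← hdiv, ← hdiv']; exact (ih r' hr' _ b' a' h2 h1 h3).symm
      · rw [← hdiv, ← hdiv']; exact ih r' hr' _ a' b' h1 h2 h3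
  choose next hnext using hstep
  let t : ∀ k, T k := fun k => Nat.rec (motive := T) ⟨(f, g), hf, hg, hg', rfl⟩ next k
  have ht : ∀ k, t (k + 1) = next k (t k) := fun k => rfl
  obtain ⟨𝔭, h𝔭, h1, hle⟩ := exists_height_one_of_strictTransform_mem (R := fun k => R (n + k))
    (fun k => hreg (n + k)) (x := fun k => x (n + k)) (x₁ := fun k => x₁ (n + k))
    (fun k => hE (n + k)) (r := r) (fun k => (t k).1.2) hg0
    (fun k => Ideal.pow_le_self hr.ne' (t k).2.2.1)
    (fun k => (ht k) ▸ (hnext k (t k)).1) (fun k => (ht k) ▸ (hnext k (t k)).2)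
  refine hswitch ⟨n, 𝔭, h𝔭, h1, Set.iUnion_subset fun m => ?_⟩
  exact (hmono (Nat.le_add_left m n)).1.trans (hle m)

/-- The union of a sequence of local quadratic transforms that switches strongly infinitely often is
a valuation ring. -/
theorem exists_valuationSubring_eq_iUnion (hfrac : IsFractionRing (R 0).toSubring K)
    (hreg : ∀ n, IsRegularLocalRing (R n).toSubring)
    (hE : ∀ n, IsExceptionalParameter (R n) (R (n + 1)) (x n) (x₁ n))
    (hswitch : SwitchesStronglyInfinitelyOften R) :
    ∃ V : ValuationSubring K, (V : Set K) = ⋃ n, ((R n).toSubring : Set K) := by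
  have hmono : Monotone R := monotone_nat_of_le_succ fun n => (hE n).le
  have hdir : Directed (· ≤ ·) fun n => (R n).toSubring :=
    Monotone.directed_le fun _ _ h => (hmono h).1
  let S : Subring K := ⨆ n, (R n).toSubring
  have hS : (S : Set K) = ⋃ n, ((R n).toSubring : Set K) := Subring.coe_iSup_of_directed hdir
  refine ⟨⟨S, fun y => ?_⟩, hS⟩
  change y ∈ (S : Set K) ∨ y⁻¹ ∈ (S : Set K)
  rw [hS]
  obtain ⟨f, g, hg, rfl⟩ := IsFractionRing.div_surjective (A := (R 0).toSubring) y
  have hg0 : g ≠ 0 := nonZeroDivisors.ne_zero hg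
  obtain ⟨N, hN⟩ : ∃ N : ℕ, g ∉ maximalIdeal (R 0).toSubring ^ N := by
    by_contra! hall
    apply hg0
    have h := Ideal.iInf_pow_eq_bot_of_isLocalRing (maximalIdeal (R 0).toSubring)
      (maximalIdeal.isMaximal _).ne_top
    rw [← Ideal.mem_bot, ← h, Ideal.mem_iInf]
    exact hall
  rw [inv_div]
  obtain ⟨r, -, h1, h2, h3 | h3⟩ := exists_le_order (f := f) (g := g) (fun h => hN h.2)
  · exact (div_mem_iUnion_or_div_mem_iUnion hreg hE hswitch r 0 g f h2 h1 h3).symm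
  · exact div_mem_iUnion_or_div_mem_iUnion hreg hE hswitch r 0 f g h1 h2 h3

/-- For a nonzero nonmaximal prime P, the localizations at the contractions of P stabilize and
contain V; a height one prime below a contraction then violates strong switching. The dimension is
positive because the first exceptional parameter stays a nonunit. -/
theorem ringKrullDim_eq_one_of_eq_iUnion (hreg : ∀ n, IsRegularLocalRing (R n).toSubring)
    (hE : ∀ n, IsExceptionalParameter (R n) (R (n + 1)) (x n) (x₁ n))
    (hswitch : SwitchesStronglyInfinitelyOften R) {V : ValuationSubring K}
    (hV : (V : Set K) = ⋃ n, ((R n).toSubring : Set K)) : ringKrullDim V = 1 := by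
  have hmono : Monotone R := monotone_nat_of_le_succ fun n => (hE n).le
  have hle : ∀ n, (R n).toSubring ≤ V.toSubring := fun n y hy => by
    change y ∈ (V : Set K)
    rw [hV]; exact Set.mem_iUnion.mpr ⟨n, hy⟩
  have hex : ∀ y : V, ∃ N, ∀ n ≥ N, (y : K) ∈ (R n).toSubring := by
    intro y
    have : (y : K) ∈ (V : Set K) := y.2
    rw [hV] at this
    obtain ⟨N, hN⟩ := Set.mem_iUnion.mp this
    exact ⟨N, fun n hn => (hmono hn).1 hN⟩
  let ι : ∀ n, (R n).toSubring →+* V := fun n => Subring.inclusion (hle n)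
  apply le_antisymm
  · have : Ring.KrullDimLE 1 V := by
      rw [Ring.krullDimLE_one_iff_of_noZeroDivisors]
      intro P hP0 hP
      suffices maximalIdeal V ≤ P by
        rw [← le_antisymm this (le_maximalIdeal hP.ne_top)]
        exact maximalIdeal.isMaximal V
      intro z hz
      by_contra hzP
      obtain ⟨N, hN⟩ := hex z
      let q : ∀ n, Ideal (R n).toSubring := fun n => P.comap (ι n)
      have hq : ∀ n, (q n).IsPrime := fun n => hP.comap (ι n)
      have hloc : ∀ n ≥ N, (LocalSubring.ofPrime (R n).toSubring (q n)).toSubring =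
          (LocalSubring.ofPrime (R (n + 1)).toSubring (q (n + 1))).toSubring := by
        intro n hn
        -- Since z lies in 𝔪ₙ, it is a multiple of x₁ in the next ring; x₁ ∈ P would force z ∈ P.
        refine (hE n).ofPrime_comap_eq (q (n + 1)) fun hx => hzP ?_
        have hzm : (⟨z, hN n hn⟩ : (R n).toSubring) ∈ maximalIdeal (R n).toSubring := by
          rw [mem_maximalIdeal]
          intro hu
          exact (mem_maximalIdeal _).mp hz (hu.map (ι n))
        obtain ⟨b, hb⟩ := (hE n).exists_mul_eq _ hzm
        have : z = ι (n + 1) b * ι (n + 1) (x₁ n) := Subtype.ext (by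
          change (z : K) = b * x₁ n
          rw [(hE n).coe_eq, hb])
        rw [this]
        exact Ideal.mul_mem_left _ _ hx
      have hall : ∀ n ≥ N, (LocalSubring.ofPrime (R N).toSubring (q N)).toSubring =
          (LocalSubring.ofPrime (R n).toSubring (q n)).toSubring := by
        intro n hn
        induction n, hn using Nat.le_induction with
        | base => rfl
        | succ n hn ih => exact ih.trans (hloc n hn)
      have hVle : V.toSubring ≤ (LocalSubring.ofPrime (R N).toSubring (q N)).toSubring := by
        intro y hy
        obtain ⟨M, hM⟩ := hex ⟨y, hy⟩
        rw [hall (max N M) (le_max_left _ _)]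
        exact LocalSubring.le_ofPrime _ _ (hM _ (le_max_right _ _))
      obtain ⟨v, hvP, hv0⟩ := Submodule.exists_mem_ne_zero_of_ne_bot hP0
      obtain ⟨a, b, hb, hab⟩ := (LocalSubring.mem_ofPrime_iff _).mp (hVle v.2)
      have hb0 : b ≠ 0 := by rintro rfl; exact hb (Ideal.zero_mem _)
      have ha0 : a ≠ 0 := by
        rintro rfl
        rcases mul_eq_zero.mp hab with h | h
        · exact hv0 (Subtype.ext h)
        · exact hb0 (Subtype.ext h)
      have haq : a ∈ q N := by
        have : ι N a = v * ι N b := Subtype.ext hab.symm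
        rw [Ideal.mem_comap, this]
        exact Ideal.mul_mem_right _ _ hvP
      obtain ⟨p, hp, hpq⟩ := Ideal.exists_minimalPrimes_le
        ((Ideal.span_singleton_le_iff_mem (q N)).mpr haq)
      have hpp := hp.1.1
      refine hswitch ⟨N, p, hpp,
        Ideal.height_eq_one_of_mem_minimalPrimes_span_singleton ha0 hp, ?_⟩
      rw [← hV]
      exact fun y hy => LocalSubring.ofPrime_anti hpq (hVle hy)
    exact this.krullDim_le
  · have hx0 : ι 0 (x 0) ≠ 0 := fun h => (hE 0).ne_zero (Subtype.ext (congrArg (fun v : V => (v : K)) h))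
    have hnu : ¬ IsUnit (ι 0 (x 0)) := by
      intro hu
      obtain ⟨w, hw⟩ := hu.exists_right_inv
      obtain ⟨N, hN⟩ := hex w
      have hloc := (hmono (Nat.zero_le N)).2
      have hxm := (mem_maximalIdeal _).mp (hE 0).mem
      refine hxm (hloc.map_nonunit _ ?_)
      refine IsUnit.of_mul_eq_one (⟨w, hN N le_rfl⟩ : (R N).toSubring) (Subtype.ext ?_)
      exact congrArg (fun v : V => (v : K)) hw
    have hnf : ¬ IsField V := fun h => hnu (h.mul_inv_cancel hx0 |>.elim fun w hw =>
      IsUnit.of_mul_eq_one w hw)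
    have h0 : ringKrullDim V ≠ 0 := by
      intro h0
      have : Ring.KrullDimLE 0 V := (Order.krullDimLE_iff 0 _).mpr h0.le
      exact hnf Ring.KrullDimLE.isField_of_isDomain
    by_contra hlt
    exact h0 (le_antisymm (ENat.WithBot.lt_add_one_iff.mp (by simpa using hlt))
      ringKrullDim_nonneg_of_nontrivial)

end QuadraticSequence

/-! ### Valuation ideals of a Noetherian subring. -/

section ValuationIdeal

variable {K : Type*} [Field K]

/-- The elements of the subring `A` of the valuation ring `V` whose value is at most that of `a`. -/
def valuationIdeal {A : Subring K} (V : ValuationSubring K) (h : A ≤ V.toSubring) (a : K) :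
    Ideal A where
  carrier := {b : A | V.valuation (b : K) ≤ V.valuation a}
  add_mem' {b c} hb hc := by
    rw [Set.mem_ofPred_eq] at hb hc ⊢
    rw [Subring.coe_add]
    exact (V.valuation.map_add _ _).trans (max_le hb hc)
  zero_mem' := by
    rw [Set.mem_ofPred_eq]
    simp
  smul_mem' c b hb := by
    rw [Set.mem_ofPred_eq] at hb ⊢
    rw [smul_eq_mul, Subring.coe_mul, map_mul]
    exact mul_le_of_le_one_of_le ((V.valuation_le_one_iff c).mpr (h c.2)) hb

theorem mem_valuationIdeal {A : Subring K} {V : ValuationSubring K} {h : A ≤ V.toSubring} {a : K}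
    {b : A} : b ∈ valuationIdeal V h a ↔ V.valuation b ≤ V.valuation a := Iff.rfl

theorem ValuationSubring.valuation_le_iff_div_mem {V : ValuationSubring K} {a b : K} (ha : a ≠ 0) :
    V.valuation b ≤ V.valuation a ↔ b / a ∈ V := by
  rw [← V.valuation_le_one_iff, map_div₀, div_le_one₀]
  exact zero_lt_iff.mpr ((V.valuation.ne_zero_iff).mpr ha)

/-- An element a of largest value generates the extension IV, so contracting IV gives the elements
of value at most v(a). -/
theorem isValuationIdealFor_iff_of_forall_le {A : Subring K} {V : ValuationSubring K}
    (h : A ≤ V.toSubring) {I : Ideal A} {a : A} (ha : a ∈ I) (ha0 : a ≠ 0)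
    (hI : ∀ b ∈ I, V.valuation (b : K) ≤ V.valuation (a : K)) :
    IsValuationIdealFor V I ↔ I = valuationIdeal V h a := by
  have ha0' : (a : K) ≠ 0 := fun h => ha0 (Subtype.ext h)
  have key : (I.map (Subring.inclusion h)).comap (Subring.inclusion h) = valuationIdeal V h a := by
    apply le_antisymm
    · have hle : I.map (Subring.inclusion h) ≤ valuationIdeal V le_rfl a := by
        rw [Ideal.map_le_iff_le_comap]
        exact fun b hb => hI b hb
      exact fun b hb => hle hb
    · intro b hb
      rw [mem_valuationIdeal, ValuationSubring.valuation_le_iff_div_mem ha0'] at hb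
      rw [Ideal.mem_comap]
      have : Subring.inclusion h b =
          (⟨(b : K) / a, hb⟩ : V.toSubring) * Subring.inclusion h a :=
        Subtype.ext (div_mul_cancel₀ _ ha0').symm
      rw [this]
      exact Ideal.mul_mem_left _ _ (Ideal.mem_map_of_mem _ ha)
  constructor
  · rintro ⟨_, hI'⟩
    rw [← key]; exact hI'.symm
  · intro hI'
    exact ⟨h, key.trans hI'.symm⟩

/-- Larger values give larger ideals, and a Noetherian ring has a maximal one among these. -/
theorem exists_forall_valuation_le {A : Subring K} [IsNoetherianRing A] {V : ValuationSubring K}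
    (h : A ≤ V.toSubring) {S : Set A} (hS : S.Nonempty) :
    ∃ a ∈ S, ∀ b ∈ S, V.valuation (b : K) ≤ V.valuation (a : K) := by
  obtain ⟨_, ⟨a, ha, rfl⟩, hmax⟩ := set_has_maximal_iff_noetherian.mpr
    (inferInstance : IsNoetherian A A) ((fun b : A => valuationIdeal V h b) '' S) (hS.image _)
  refine ⟨a, ha, fun b hb => ?_⟩
  by_contra hlt
  rw [not_le] at hlt
  refine hmax _ ⟨b, hb, rfl⟩ (lt_of_le_not_ge (fun c hc => ?_) fun hle => ?_)
  · exact le_trans (mem_valuationIdeal.mp hc) hlt.le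
  · exact absurd (mem_valuationIdeal.mp (hle (mem_valuationIdeal.mpr le_rfl : b ∈ _))) hlt.not_ge

theorem isValuationIdealFor_iff_exists {A : Subring K} [IsNoetherianRing A] {V : ValuationSubring K}
    (h : A ≤ V.toSubring) {I : Ideal A} (hI : I ≠ ⊥) :
    IsValuationIdealFor V I ↔ ∃ a : A, a ≠ 0 ∧ I = valuationIdeal V h a := by
  constructor
  · intro hV
    obtain ⟨a, ha, hmax⟩ := exists_forall_valuation_le (V := V) h (S := (I : Set A)) ⟨0, I.zero_mem⟩
    have ha0 : a ≠ 0 := by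
      rintro rfl
      obtain ⟨b, hb, hb0⟩ := Submodule.exists_mem_ne_zero_of_ne_bot hI
      have := hmax b hb
      rw [ZeroMemClass.coe_zero, map_zero, le_zero_iff, map_eq_zero] at this
      exact hb0 (Subtype.ext this)
    exact ⟨a, ha0, (isValuationIdealFor_iff_of_forall_le h ha ha0 hmax).mp hV⟩
  · rintro ⟨a, ha0, hIa⟩
    refine (isValuationIdealFor_iff_of_forall_le h (a := a) ?_ ha0 ?_).mpr hIa
    · rw [hIa]; exact mem_valuationIdeal.mpr le_rfl
    · intro b hb
      rw [hIa] at hb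
      exact mem_valuationIdeal.mp hb

theorem Dominates.toSubring_le {V : ValuationSubring K} {R : LocalSubring K}
    (h : Dominates V R) : R.toSubring ≤ V.toSubring := h.1

theorem Dominates.valuation_lt_one {V : ValuationSubring K} {R : LocalSubring K}
    (h : Dominates V R) {z : R.toSubring} (hz : z ∈ maximalIdeal R.toSubring) :
    V.valuation (z : K) < 1 := by
  have := h.2
  have hnu : ¬ IsUnit (Subring.inclusion h.1 z) := fun hu =>
    (mem_maximalIdeal z).mp hz (this.map_nonunit z hu)
  exact (V.valuation_lt_one_iff (⟨z, h.1 z.2⟩ : V)).mp ((mem_maximalIdeal _).mpr hnu)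

theorem Dominates.valuation_eq_one_of_isUnit {V : ValuationSubring K} {R : LocalSubring K}
    (h : Dominates V R) {z : R.toSubring} (hz : IsUnit z) : V.valuation (z : K) = 1 := by
  obtain ⟨w, hw⟩ := hz.exists_right_inv
  have hw' : V.valuation (z : K) * V.valuation (w : K) = 1 := by
    rw [← map_mul, ← map_one V.valuation]; exact congrArg _ (congrArg Subtype.val hw)
  have h1 := (V.valuation_le_one_iff z).mpr (h.1 z.2)
  have h2 := (V.valuation_le_one_iff w).mpr (h.1 w.2)
  refine le_antisymm h1 ?_
  rw [← hw']
  exact mul_le_of_le_one_right' h2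

theorem Dominates.valuation_lt_one_iff {V : ValuationSubring K} {R : LocalSubring K}
    (h : Dominates V R) {z : R.toSubring} :
    V.valuation (z : K) < 1 ↔ z ∈ maximalIdeal R.toSubring := by
  refine ⟨fun hlt => ?_, h.valuation_lt_one⟩
  rw [mem_maximalIdeal]
  exact fun hu => hlt.ne (h.valuation_eq_one_of_isUnit hu)

/-- In rank at most one every nonzero prime of V is maximal, so each element of 𝔪 has a power
divisible by b in V; finite generation of 𝔪 makes the exponent uniform. -/
theorem exists_maximalIdeal_pow_le_valuationIdeal {R : LocalSubring K}
    [IsNoetherianRing R.toSubring] {V : ValuationSubring K} (hV : Dominates V R)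
    (hdim : ringKrullDim V ≤ 1) {b : R.toSubring} (hb : b ≠ 0) :
    ∃ k, maximalIdeal R.toSubring ^ k ≤ valuationIdeal V hV.toSubring_le b := by
  have hdim' : Ring.KrullDimLE 1 V := (Order.krullDimLE_iff 1 _).mpr hdim
  rw [Ring.krullDimLE_one_iff_of_noZeroDivisors] at hdim'
  apply Ideal.exists_pow_le_of_le_radical_of_fg _ (Ideal.fg_of_isNoetherianRing _)
  intro z hz
  let b' : V := ⟨b, hV.1 b.2⟩
  let z' : V := ⟨z, hV.1 z.2⟩
  have hz' : z' ∈ (Ideal.span {b'}).radical := by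
    rw [Ideal.radical_eq_sInf, Ideal.mem_sInf]
    rintro P ⟨hbP, hP⟩
    have hb'0 : b' ≠ 0 := fun h => hb (Subtype.ext (congrArg (fun v : V => (v : K)) h))
    have hP0 : P ≠ ⊥ := by
      rintro rfl
      exact hb'0 (by simpa using hbP (Ideal.mem_span_singleton_self b'))
    rw [IsLocalRing.eq_maximalIdeal (hdim' P hP0 hP), V.valuation_lt_one_iff]
    exact hV.valuation_lt_one hz
  obtain ⟨k, hk⟩ := hz'
  obtain ⟨c, hc⟩ := Ideal.mem_span_singleton'.mp hk
  refine ⟨k, ?_⟩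
  rw [mem_valuationIdeal]
  have hc' : ((z ^ k : R.toSubring) : K) = c * b := (congrArg (fun v : V => (v : K)) hc).symm
  rw [hc', map_mul]
  exact mul_le_of_le_one_left' ((V.valuation_le_one_iff c).mpr c.2)

theorem IsLocalRing.isArtinianRing_quotient_maximalIdeal_pow (A : Type*) [CommRing A]
    [IsLocalRing A] [IsNoetherianRing A] {k : ℕ} (hk : k ≠ 0) :
    IsArtinianRing (A ⧸ maximalIdeal A ^ k) :=
  quotient_artinian_of_mem_minimalPrimes_of_isLocalRing _
    ⟨⟨inferInstance, Ideal.pow_le_self hk⟩, fun _ hq _ => hq.1.le_of_pow_le hq.2⟩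

/-- The values that a valuation of rank at most one takes on the nonzero elements of a Noetherian
local ring that it dominates form a descending sequence of order type at most `ω`. -/
theorem exists_forall_valuation_eq {R : LocalSubring K} [IsNoetherianRing R.toSubring]
    {V : ValuationSubring K} (hV : Dominates V R) (hdim : ringKrullDim V ≤ 1)
    {a : ℕ → R.toSubring} (ha1 : V.valuation (a 0 : K) = 1)
    (hlt : ∀ n, V.valuation (a (n + 1) : K) < V.valuation (a n : K))
    (hstep : ∀ n (b : R.toSubring), V.valuation (b : K) < V.valuation (a n : K) →
      V.valuation (b : K) ≤ V.valuation (a (n + 1) : K)) {b : R.toSubring} (hb : b ≠ 0) :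
    ∃ n, V.valuation (b : K) = V.valuation (a n : K) := by
  have hex : ∃ n, V.valuation (a n : K) ≤ V.valuation (b : K) := by
    by_contra! hall
    obtain ⟨k, hk⟩ := exists_maximalIdeal_pow_le_valuationIdeal hV hdim hb
    -- If every v(aₙ) exceeded v(b), an infinite strictly descending chain of ideals would contain a
    -- fixed power of 𝔪, against the Artinian quotient. The exponent k + 1 is nonzero, as that
    -- quotient lemma requires.
    have hk' : ∀ n, maximalIdeal R.toSubring ^ (k + 1) ≤ valuationIdeal V hV.toSubring_le (a n) := fun n =>
      (Ideal.pow_le_pow_right (Nat.le_succ k)).trans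
        (hk.trans fun c hc => le_trans (mem_valuationIdeal.mp hc) (hall n).le)
    have := isArtinianRing_quotient_maximalIdeal_pow R.toSubring (Nat.succ_ne_zero k)
    let mk := Ideal.Quotient.mk (maximalIdeal R.toSubring ^ (k + 1))
    have hanti : Antitone fun n => (valuationIdeal V hV.toSubring_le (a n : K)).map mk :=
      antitone_nat_of_succ_le fun n => Ideal.map_mono fun c hc =>
        le_trans (mem_valuationIdeal.mp hc) (hlt n).le
    obtain ⟨n, hn⟩ := IsArtinian.monotone_stabilizes
      (⟨fun n => OrderDual.toDual ((valuationIdeal V hV.toSubring_le (a n : K)).map mk), fun _ _ h => hanti h⟩ :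
        ℕ →o (Ideal (R.toSubring ⧸ maximalIdeal R.toSubring ^ (k + 1)))ᵒᵈ)
    have heq : (valuationIdeal V hV.toSubring_le (a n : K)).map mk =
        (valuationIdeal V hV.toSubring_le (a (n + 1) : K)).map mk := hn (n + 1) (Nat.le_succ n)
    have hc : ∀ m, ((valuationIdeal V hV.toSubring_le (a m : K)).map mk).comap mk =
        valuationIdeal V hV.toSubring_le (a m : K) := fun m => by
      rw [Ideal.comap_map_of_surjective' mk Ideal.Quotient.mk_surjective, Ideal.mk_ker,
        sup_eq_left.mpr (hk' m)]
    have heq' : valuationIdeal V hV.toSubring_le (a n : K) = valuationIdeal V hV.toSubring_le (a (n + 1) : K) := by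
      rw [← hc n, heq, hc]
    have hmem : a n ∈ valuationIdeal V hV.toSubring_le (a n : K) := mem_valuationIdeal.mpr le_rfl
    rw [heq', mem_valuationIdeal] at hmem
    exact (hlt n).not_ge hmem
  classical
  refine ⟨Nat.find hex, le_antisymm ?_ (Nat.find_spec hex)⟩
  rcases h : Nat.find hex with _ | m
  · rw [ha1]; exact (V.valuation_le_one_iff _).mpr (hV.1 b.2)
  · refine hstep m b (not_le.mp (Nat.find_min hex ?_))
    rw [h]; exact Nat.lt_succ_self m

theorem exists_valuation_sequence {R : LocalSubring K} [IsNoetherianRing R.toSubring]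
    {V : ValuationSubring K} (hV : Dominates V R) {z : R.toSubring}
    (hz : z ∈ maximalIdeal R.toSubring) (hz0 : z ≠ 0) :
    ∃ a : ℕ → R.toSubring, (∀ n, a n ≠ 0) ∧ V.valuation (a 0 : K) = 1 ∧
      (∀ n, V.valuation (a (n + 1) : K) < V.valuation (a n : K)) ∧
      ∀ n (b : R.toSubring), V.valuation (b : K) < V.valuation (a n : K) →
        V.valuation (b : K) ≤ V.valuation (a (n + 1) : K) := by
  have hstep : ∀ a : {a : R.toSubring // a ≠ 0}, ∃ a' : {a : R.toSubring // a ≠ 0},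
      V.valuation (a'.1 : K) < V.valuation (a.1 : K) ∧
      ∀ b : R.toSubring, V.valuation (b : K) < V.valuation (a.1 : K) →
        V.valuation (b : K) ≤ V.valuation (a'.1 : K) := by
    rintro ⟨a, ha⟩
    -- The multiple za shows that smaller nonzero values exist; the next term takes the largest of
    -- them.
    have hza : V.valuation ((z * a : R.toSubring) : K) < V.valuation (a : K) := by
      push_cast
      rw [map_mul]
      refine mul_lt_of_lt_one_left ?_ (hV.valuation_lt_one hz)
      exact zero_lt_iff.mpr ((V.valuation.ne_zero_iff).mpr fun h => ha (Subtype.ext h))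
    obtain ⟨a', ha', hmax⟩ := exists_forall_valuation_le (V := V) hV.toSubring_le
      (S := {b : R.toSubring | V.valuation (b : K) < V.valuation (a : K)}) ⟨z * a, hza⟩
    refine ⟨⟨a', ?_⟩, ha', hmax⟩
    rintro rfl
    have := hmax _ hza
    rw [ZeroMemClass.coe_zero, map_zero, le_zero_iff, map_eq_zero] at this
    exact mul_ne_zero hz0 ha (Subtype.ext this)
  choose next hnext using hstep
  let t : ℕ → {a : R.toSubring // a ≠ 0} := fun n => Nat.rec ⟨1, one_ne_zero⟩ (fun _ => next) n
  refine ⟨fun n => (t n).1, fun n => (t n).2, ?_, fun n => ?_, fun n b hb => ?_⟩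
  · change V.valuation ((1 : R.toSubring) : K) = 1
    rw [OneMemClass.coe_one, map_one]
  · exact (hnext (t n)).1
  · exact (hnext (t n)).2 b hb

end ValuationIdeal

/-! ### From V to valuations dominating a late ring. -/

section QuadraticSequence

variable {K : Type*} [Field K] {R : ℕ → LocalSubring K}

theorem Dominates.of_eq_iUnion (hmono : Monotone R) {V : ValuationSubring K}
    (hV : (V : Set K) = ⋃ n, ((R n).toSubring : Set K)) (n : ℕ) : Dominates V (R n) := by
  have hle : ∀ n, (R n).toSubring ≤ V.toSubring := fun n y hy => by
    change y ∈ (V : Set K)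
    rw [hV]; exact Set.mem_iUnion.mpr ⟨n, hy⟩
  refine ⟨hle n, ⟨fun z hz => ?_⟩⟩
  obtain ⟨w, hw⟩ := hz.exists_right_inv
  have hwV : (w : K) ∈ (V : Set K) := w.2
  rw [hV] at hwV
  obtain ⟨m, hm⟩ := Set.mem_iUnion.mp hwV
  have hnM := hmono (le_max_left n m)
  refine hnM.2.map_nonunit z (IsUnit.of_mul_eq_one
    (⟨w, (hmono (le_max_right n m)).1 hm⟩ : (R (max n m)).toSubring) (Subtype.ext ?_))
  exact congrArg (fun v : V.toLocalSubring.toSubring => (v : K)) hw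

/-- The generators of a valuation ideal become multiples of an element of maximal value in some
ring of the sequence. -/
theorem exists_forall_div_mem (hmono : Monotone R) [IsNoetherianRing (R 0).toSubring]
    {V : ValuationSubring K} (hV : (V : Set K) = ⋃ n, ((R n).toSubring : Set K)) {a : (R 0).toSubring}
    (ha : a ≠ 0) : ∃ T, ∀ b : (R 0).toSubring, V.valuation (b : K) ≤ V.valuation (a : K) →
      (b : K) / a ∈ (R T).toSubring := by
  have ha0 : (a : K) ≠ 0 := fun h => ha (Subtype.ext h)
  have hle := (Dominates.of_eq_iUnion hmono hV 0).toSubring_le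
  obtain ⟨t, ht⟩ := (valuationIdeal V hle (a : K)).fg_of_isNoetherianRing
  have hex : ∀ b : (R 0).toSubring, ∃ n, b ∈ t → (b : K) / a ∈ (R n).toSubring := by
    intro b
    by_cases hb : b ∈ t
    · have hbI : b ∈ valuationIdeal V hle (a : K) := ht ▸ Ideal.subset_span hb
      have hbV : (b : K) / a ∈ (V : Set K) :=
        (ValuationSubring.valuation_le_iff_div_mem ha0).mp (mem_valuationIdeal.mp hbI)
      rw [hV] at hbV
      obtain ⟨n, hn⟩ := Set.mem_iUnion.mp hbV
      exact ⟨n, fun _ => hn⟩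
    · exact ⟨0, fun h => absurd h hb⟩
  choose ν hν using hex
  refine ⟨t.sup ν, fun b hb => ?_⟩
  have hbI : b ∈ Ideal.span (t : Set (R 0).toSubring) := by
    rw [ht]; exact mem_valuationIdeal.mpr hb
  induction hbI using Submodule.span_induction with
  | mem b hbt => exact (hmono (Finset.le_sup hbt)).1 (hν b hbt)
  | zero => simp
  | add b c hb' hc' hb'' hc'' =>
    have h1 := mem_valuationIdeal.mp (ht.le hb')
    have h2 := mem_valuationIdeal.mp (ht.le hc')
    rw [Subring.coe_add, add_div]
    exact add_mem (hb'' h1) (hc'' h2)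
  | smul c b hb' hb'' =>
    have h1 := mem_valuationIdeal.mp (ht.le hb')
    rw [smul_eq_mul, Subring.coe_mul, mul_div_assoc]
    exact mul_mem ((hmono (Nat.zero_le _)).1 c.2) (hb'' h1)

/-- Both V and W dominate R_T, so a quotient b/aᵢ in R_T is a unit for both or lies in both maximal
ideals. Equalities and strict inequalities of V-values with v(aᵢ), i ≤ n, thus transfer to W. -/
theorem isValuationIdealFor_of_dominates (hmono : Monotone R) {V : ValuationSubring K}
    (hV : (V : Set K) = ⋃ n, ((R n).toSubring : Set K)) {a : ℕ → (R 0).toSubring}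
    (ha0 : ∀ n, a n ≠ 0)
    (hlt : ∀ n, V.valuation (a (n + 1) : K) < V.valuation (a n : K))
    (hval : ∀ b : (R 0).toSubring, b ≠ 0 → ∃ n, V.valuation (b : K) = V.valuation (a n : K))
    {T n : ℕ} (hT : ∀ i ≤ n, ∀ b : (R 0).toSubring, V.valuation (b : K) ≤ V.valuation (a i : K) →
      (b : K) / a i ∈ (R T).toSubring) {W : ValuationSubring K} (hW : Dominates W (R T)) {i : ℕ}
    (hi : i ≤ n) (h : (R 0).toSubring ≤ V.toSubring) :
    IsValuationIdealFor W (valuationIdeal V h (a i)) := by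
  have hV' := Dominates.of_eq_iUnion hmono hV
  have haK : ∀ n, (a n : K) ≠ 0 := fun n h => ha0 n (Subtype.ext h)
  have hle : (R 0).toSubring ≤ W.toSubring := (hmono (Nat.zero_le T)).1.trans hW.toSubring_le
  have hwa : ∀ i, 0 < W.valuation (a i : K) := fun i =>
    zero_lt_iff.mpr ((W.valuation.ne_zero_iff).mpr (haK i))
  have hva : ∀ i, 0 < V.valuation (a i : K) := fun i =>
    zero_lt_iff.mpr ((V.valuation.ne_zero_iff).mpr (haK i))
  have hWle : ∀ i ≤ n, ∀ b : (R 0).toSubring, V.valuation (b : K) ≤ V.valuation (a i : K) →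
      W.valuation (b : K) ≤ W.valuation (a i : K) := fun i hi b hb =>
    (ValuationSubring.valuation_le_iff_div_mem (haK i)).mpr (hW.toSubring_le (hT i hi b hb))
  have hWeq : ∀ i ≤ n, ∀ b : (R 0).toSubring, V.valuation (b : K) = V.valuation (a i : K) →
      W.valuation (b : K) = W.valuation (a i : K) := by
    intro i hi b hb
    let u : (R T).toSubring := ⟨(b : K) / a i, hT i hi b hb.le⟩
    have hu : IsUnit u := by
      by_contra hnu
      have h1 := (hV' T).valuation_lt_one ((mem_maximalIdeal u).mpr hnu)
      rw [map_div₀, hb, div_self (hva i).ne'] at h1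
      exact lt_irrefl _ h1
    have h1 := hW.valuation_eq_one_of_isUnit hu
    rwa [map_div₀, div_eq_one_iff_eq (hwa i).ne'] at h1
  have hWlt : ∀ i, i + 1 ≤ n → W.valuation (a (i + 1) : K) < W.valuation (a i : K) := by
    intro i hi
    let u : (R T).toSubring := ⟨(a (i + 1) : K) / a i, hT i (by omega) _ (hlt i).le⟩
    have hu : u ∈ maximalIdeal (R T).toSubring := by
      rw [← (hV' T).valuation_lt_one_iff, map_div₀, div_lt_one₀ (hva i)]
      exact hlt i
    have h1 := hW.valuation_lt_one hu
    rwa [map_div₀, div_lt_one₀ (hwa i)] at h1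
  have hWanti : ∀ i ≤ n, ∀ j < i, W.valuation (a i : K) < W.valuation (a j : K) := by
    intro i
    induction i with
    | zero => intro _ j hj; exact absurd hj (Nat.not_lt_zero j)
    | succ i ih =>
      intro hi j hj
      rcases Nat.lt_succ_iff_lt_or_eq.mp hj with hj | rfl
      · exact (hWlt i hi).trans (ih (by omega) j hj)
      · exact hWlt j hi
  have hVanti : StrictAnti fun n => V.valuation (a n : K) := strictAnti_nat_of_succ_lt hlt
  refine (isValuationIdealFor_iff_of_forall_le hle (a := a i)
    (mem_valuationIdeal.mpr le_rfl) (ha0 i) fun b hb => hWle i hi b (mem_valuationIdeal.mp hb)).mpr ?_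
  ext b
  rw [mem_valuationIdeal, mem_valuationIdeal]
  refine ⟨hWle i hi b, fun hb => ?_⟩
  by_contra hcon
  rw [not_le] at hcon
  have hb0 : b ≠ 0 := by
    rintro rfl
    rw [ZeroMemClass.coe_zero, map_zero] at hcon
    exact not_lt_zero hcon
  -- An element outside the ideal has the V-value of an earlier aⱼ, hence also its W-value, which
  -- exceeds that of aᵢ.
  obtain ⟨j, hj⟩ := hval b hb0
  have hji : j < i := by
    rw [hj] at hcon
    exact hVanti.lt_iff_gt.mp hcon
  rw [hWeq j (by omega) b hj] at hb
  exact (hWanti i hi j hji).not_ge hb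

end QuadraticSequence

/-! ### The main theorem. -/

theorem mainTheorem9 {K : Type*} [Field K] (R : ℕ → LocalSubring K)
    (hfrac : IsFractionRing (R 0).toSubring K)
    (hreg : IsRegularLocalRing (R 0).toSubring)
    (hquad : ∀ n, IsLocalQuadraticTransform (R n) (R (n + 1)))
    (hswitch : SwitchesStronglyInfinitelyOften R) :
    ∃ V : ValuationSubring K,
      (V : Set K) = ⋃ n, ((R n).toSubring : Set K) ∧
      ringKrullDim V = 1 ∧
      ∃ I : ℕ → Ideal (R 0).toSubring,
        StrictAnti I ∧
        (∀ J : Ideal (R 0).toSubring,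
          (∃ n, I n = J) ↔ J ≠ ⊥ ∧ IsValuationIdealFor V J) ∧
        (⨅ n, I n) = ⊥ ∧
        ∃ τ : ℕ → ℕ, StrictMono τ ∧
          ∀ (n : ℕ) (W : ValuationSubring K), Dominates W (R (τ n)) →
            ∀ i, 1 ≤ i → i ≤ n → IsValuationIdealFor W (I i) := by
  have hregn : ∀ n, IsRegularLocalRing (R n).toSubring := by
    intro n
    induction n with
    | zero => exact hreg
    | succ n ih => exact ((hquad n).exists_isExceptionalParameter ih).1
  choose x x₁ hE using fun n => ((hquad n).exists_isExceptionalParameter (hregn n)).2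
  have hmono : Monotone R := monotone_nat_of_le_succ fun n => (hE n).le
  obtain ⟨V, hV⟩ := exists_valuationSubring_eq_iUnion hfrac hregn hE hswitch
  have hdim := ringKrullDim_eq_one_of_eq_iUnion hregn hE hswitch hV
  have hdom := Dominates.of_eq_iUnion hmono hV 0
  obtain ⟨a, ha0, ha1, hlt, hstep⟩ := exists_valuation_sequence hdom (hE 0).mem (hE 0).ne_zero
  have hval : ∀ b : (R 0).toSubring, b ≠ 0 → ∃ n, V.valuation (b : K) = V.valuation (a n : K) :=
    fun b hb => exists_forall_valuation_eq hdom hdim.le ha1 hlt hstep hb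
  have hVanti : StrictAnti fun n => V.valuation (a n : K) := strictAnti_nat_of_succ_lt hlt
  -- Since a₀ has value one, I₀ is the whole ring.
  refine ⟨V, hV, hdim, fun n => valuationIdeal V hdom.toSubring_le (a n), ?_, ?_, ?_, ?_⟩
  · refine strictAnti_nat_of_succ_lt fun n => lt_of_le_not_ge (fun c hc => ?_) fun hle => ?_
    · exact le_trans (mem_valuationIdeal.mp hc) (hlt n).le
    · have hmem : a n ∈ valuationIdeal V hdom.toSubring_le (a n) := mem_valuationIdeal.mpr le_rfl
      exact (hlt n).not_ge (mem_valuationIdeal.mp (hle hmem))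
  · intro J
    constructor
    · rintro ⟨n, rfl⟩
      have hne : valuationIdeal V hdom.toSubring_le (a n : K) ≠ ⊥ := by
        intro h
        have hmem : a n ∈ valuationIdeal V hdom.toSubring_le (a n) := mem_valuationIdeal.mpr le_rfl
        rw [h] at hmem
        exact ha0 n hmem
      exact ⟨hne, (isValuationIdealFor_iff_exists hdom.toSubring_le hne).mpr ⟨a n, ha0 n, rfl⟩⟩
    · rintro ⟨hJ, hJV⟩
      obtain ⟨b, hb0, rfl⟩ := (isValuationIdealFor_iff_exists hdom.toSubring_le hJ).mp hJV
      obtain ⟨n, hn⟩ := hval b hb0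
      refine ⟨n, ?_⟩
      ext c
      rw [mem_valuationIdeal, mem_valuationIdeal, hn]
  · rw [eq_bot_iff]
    intro b hb
    by_contra hb0
    obtain ⟨n, hn⟩ := hval b hb0
    have h1 := mem_valuationIdeal.mp ((Ideal.mem_iInf.mp hb) (n + 1))
    rw [hn] at h1
    exact (hlt n).not_ge h1
  · choose T hT using fun n => exists_forall_div_mem hmono hV (ha0 n)
    have hsum : ∀ i n, i ≤ n → T i ≤ n + ∑ j ∈ Finset.range (n + 1), T j := fun i n hi =>
      (Finset.single_le_sum (f := T) (fun _ _ => Nat.zero_le _)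
        (Finset.mem_range.mpr (Nat.lt_succ_of_le hi))).trans (Nat.le_add_left _ _)
    -- The sum dominates T i for all i ≤ n; the summand n makes the sequence strictly increasing.
    refine ⟨fun n => n + ∑ j ∈ Finset.range (n + 1), T j, ?_, ?_⟩
    · refine strictMono_nat_of_lt_succ fun n => ?_
      rw [Finset.sum_range_succ _ (n + 1)]
      omega
    · intro n W hW i _ hi
      exact isValuationIdealFor_of_dominates hmono hV ha0 hlt hval
        (fun j hj b hb => (hmono (hsum j n hj)).1 (hT j b hb)) hW hi _
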